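/- Let $\beta>0$, $J>0$ and let $h=(h_i)_{i\ge1}\in\mathbb R^{\mathbb N}$ be strongly varying, i.e. $$m^\parallel:=\lim_{n\to\infty}\frac1n\sum_{i=1}^n h_i\in\mathbb R,\qquad m^\perp:=\lim_{n\to\infty}\sqrt{\frac1n\sum_{i=1}^n h_i^2-\Big(\frac1n\sum_{i=1}^n h_i\Big)^2}\in(0,\infty)$$ both exist. For $n\ge1$ let $\mu_n^{\beta,J,h}$ be the probability measure on the sphere of radius $\sqrt n$ in $\mathbb R^n$ whose density with respect to the uniform (surface) measure is proportional to $e^{-\beta H_n(\phi)}$, where $H_n(\phi)=-\frac{J}{2n}\sum_{i,j=1}^n\phi_i\phi_j-\sum_{i=1}^n h_i\phi_i$, regarded as a probability measure on $\mathbb R^{\mathbb N}$ by setting all components with index larger than $n$ equal to $0$. Let $\mathcal G_\infty(\beta,J,h)$ be the set of infinite-volume Gibbs states, i.e. of all weak limits in $\mathcal M_1(\mathbb R^{\mathbb N})$ of subsequences $(\mu_{n_k}^{\beta,J,h})_k$, $n_1<n_2<\cdots$. On the open unit disk $B(0,1)\subset\mathbb R^2$, with $z=(x,y)$, put $$\psi(z)=\frac{\beta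 J}{2}x^2+\beta\,(m^\parallel x+m^\perp y)+\frac12\ln(1-\|z\|^2),$$ and let $M^*\subset B(0,1)$ be its set of global maximizing points. For $z=(x,y)\in B(0,1)$ let $\nu_\infty^{z,h}$ be the push-forward of the standard Gaussian measure on $\mathbb R^{\mathbb N}$ (the product of countably many copies of $N(0,1)$) under the affine map $$T(\phi)=\sqrt{1-\|z\|^2}\,\phi+x\,\mathbf 1+y\,\frac{h-m^\parallel\mathbf 1}{m^\perp},$$ where $\mathbf 1$ is the sequence with all components $1$. 1. (Pure state range.) If $M^*$ consists of a single element $z^*$, then $\mathcal G_\infty(\beta,J,h)=\{\nu_\infty^{z^*,h}\}$. 2. (Mixed state range.) If $M^*$ consists of exactly two elements, then $M^*=\{z^+,z^-\}$ with $x^+>0>x^-$, and $$\mathcal G_\infty(\beta,J,h)\subset\{\lambda\,\nu_\infty^{z^+,h}+(1-\lambda)\,\nu_\infty^{z^-,h}:\lambda\in[0,1]\}.$$ -/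

import Mathlib

open MeasureTheory ProbabilityTheory Filter Topology

noncomputable section

namespace MeanFieldSpherical

/-- The mean-field Hamiltonian
`H_n(φ) = -(J / (2n)) ∑_{i,j} φ_i φ_j - ∑_i h_i φ_i` on `ℝⁿ`. Sites are numbered from `0`. -/
def hamiltonian (J : ℝ) (h : ℕ → ℝ) (n : ℕ) (φ : EuclideanSpace ℝ (Fin n)) : ℝ :=
  -(J / (2 * n)) * ∑ i, ∑ j, φ i * φ j - ∑ i : Fin n, h i * φ i

/-- Extension of a configuration in `ℝⁿ` by `0` to a configuration in `ℝ^ℕ`. -/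
def zeroExtend (n : ℕ) (φ : EuclideanSpace ℝ (Fin n)) : ℕ → ℝ :=
  fun i => if hi : i < n then φ ⟨i, hi⟩ else 0

lemma continuous_hamiltonian (J : ℝ) (h : ℕ → ℝ) (n : ℕ) : Continuous (hamiltonian J h n) := by
  unfold hamiltonian
  fun_prop

lemma continuous_zeroExtend (n : ℕ) : Continuous (zeroExtend n) := by
  refine continuous_pi fun i => ?_
  by_cases hi : i < n
  · simp only [zeroExtend, hi, dite_true]
    fun_prop
  · simp only [zeroExtend, hi, dite_false]
    fun_prop

/-- The Gibbs weight on the unit sphere of `ℝⁿ`: the surface measure `dΩ` with density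
`exp (-β H_n(√n Ω))`, normalised to total mass one. -/
def sphereGibbs (β J : ℝ) (h : ℕ → ℝ) (n : ℕ) :
    Measure (Metric.sphere (0 : EuclideanSpace ℝ (Fin n)) 1) :=
  (volume : Measure (EuclideanSpace ℝ (Fin n))).toSphere.tilted
    fun Ω => -β * hamiltonian J h n (√(n : ℝ) • (Ω : EuclideanSpace ℝ (Fin n)))

/-- The finite-volume Gibbs state as a measure on `ℝ^ℕ`: the law of `√n Ω`, extended by `0`. -/
def gibbsMeasure (β J : ℝ) (h : ℕ → ℝ) (n : ℕ) : Measure (ℕ → ℝ) :=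
  (sphereGibbs β J h n).map
    fun Ω : Metric.sphere (0 : EuclideanSpace ℝ (Fin n)) 1 =>
      zeroExtend n (√(n : ℝ) • (Ω : EuclideanSpace ℝ (Fin n)))

lemma isProbabilityMeasure_gibbsMeasure (β J : ℝ) (h : ℕ → ℝ) (n : ℕ+) :
    IsProbabilityMeasure (gibbsMeasure β J h n) := by
  have : NeZero (n : ℕ) := ⟨n.ne_zero⟩
  have : Nontrivial (EuclideanSpace ℝ (Fin (n : ℕ))) := inferInstance
  have hS : IsProbabilityMeasure (sphereGibbs β J h n) := by
    have : NeZero (volume : Measure (EuclideanSpace ℝ (Fin (n : ℕ)))).toSphere :=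
      ⟨Measure.toSphere_ne_zero _⟩
    refine isProbabilityMeasure_tilted ?_
    refine Continuous.integrable_of_hasCompactSupport ?_ (HasCompactSupport.of_compactSpace _)
    have := continuous_hamiltonian J h n
    fun_prop
  refine Measure.isProbabilityMeasure_map (Continuous.aemeasurable ?_)
  exact (continuous_zeroExtend n).comp (by fun_prop)

/-- The finite-volume Gibbs state `μ_n^{β,J,h}`, `n ≥ 1`. -/
def gibbsState (β J : ℝ) (h : ℕ → ℝ) (n : ℕ+) : ProbabilityMeasure (ℕ → ℝ) :=
  ⟨gibbsMeasure β J h n, isProbabilityMeasure_gibbsMeasure β J h n⟩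

/-- The infinite-volume Gibbs states: all weak limits of subsequences of the finite-volume
Gibbs states. -/
def infiniteVolumeGibbsStates (β J : ℝ) (h : ℕ → ℝ) : Set (ProbabilityMeasure (ℕ → ℝ)) :=
  {μ | ∃ k : ℕ → ℕ+, StrictMono k ∧ Tendsto (fun j => gibbsState β J h (k j)) atTop (𝓝 μ)}

/-- The sample mean of the first `n` components of the field. -/
def sampleMean (h : ℕ → ℝ) (n : ℕ) : ℝ :=
  (∑ i ∈ Finset.range n, h i) / n

/-- The sample standard deviation of the first `n` components of the field. -/
def sampleStd (h : ℕ → ℝ) (n : ℕ) : ℝ :=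
  √((∑ i ∈ Finset.range n, h i ^ 2) / n - sampleMean h n ^ 2)

/-- `h` is strongly varying, with limiting sample mean `m.1` and limiting sample standard
deviation `m.2 > 0`. -/
def IsStronglyVarying (h : ℕ → ℝ) (m : ℝ × ℝ) : Prop :=
  Tendsto (fun n => (sampleMean h n, sampleStd h n)) atTop (𝓝 m) ∧ 0 < m.2

/-- The open Euclidean unit disk in `ℝ²`. -/
def disk : Set (ℝ × ℝ) := {z | z.1 ^ 2 + z.2 ^ 2 < 1}

/-- The limiting exponential tilting function
`ψ(z) = (βJ/2) x² + β ⟨m, z⟩ + (1/2) log (1 - ‖z‖²)`, `z = (x, y)` in the disk. -/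
def tilting (β J : ℝ) (m z : ℝ × ℝ) : ℝ :=
  β * J / 2 * z.1 ^ 2 + β * (m.1 * z.1 + m.2 * z.2)
    + 1 / 2 * Real.log (1 - (z.1 ^ 2 + z.2 ^ 2))

/-- The set of global maximising points of the limiting exponential tilting function. -/
def maximizers (β J : ℝ) (m : ℝ × ℝ) : Set (ℝ × ℝ) :=
  {z | z ∈ disk ∧ ∀ w ∈ disk, tilting β J m w ≤ tilting β J m z}

/-- The standard Gaussian measure on `ℝ^ℕ`. -/
def standardGaussian : Measure (ℕ → ℝ) :=
  Measure.infinitePi fun _ : ℕ => gaussianReal 0 1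

instance : IsProbabilityMeasure standardGaussian := by
  unfold standardGaussian
  infer_instance

/-- The affine map `T(φ) = √(1 - ‖z‖²) φ + x 1 + y (h - m.1 1) / m.2`, `z = (x, y)`. -/
def transport (h : ℕ → ℝ) (m z : ℝ × ℝ) (φ : ℕ → ℝ) : ℕ → ℝ :=
  fun i => √(1 - (z.1 ^ 2 + z.2 ^ 2)) * φ i + z.1 + z.2 * ((h i - m.1) / m.2)

lemma measurable_transport (h : ℕ → ℝ) (m z : ℝ × ℝ) : Measurable (transport h m z) := by
  unfold transport
  fun_prop

/-- `ν_∞^{z,h}`, the push-forward of the standard Gaussian measure under the affine map. -/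
def pureState (h : ℕ → ℝ) (m z : ℝ × ℝ) : ProbabilityMeasure (ℕ → ℝ) :=
  ⟨standardGaussian.map (transport h m z),
    Measure.isProbabilityMeasure_map (measurable_transport h m z).aemeasurable⟩

/-- The convex combinations `t ν₁ + (1 - t) ν₂`, `t ∈ [0, 1]`. -/
def convPair (ν₁ ν₂ : ProbabilityMeasure (ℕ → ℝ)) : Set (ProbabilityMeasure (ℕ → ℝ)) :=
  {μ | ∃ t ∈ Set.Icc (0 : ℝ) 1,
    (μ : Measure (ℕ → ℝ)) = ENNReal.ofReal t • (ν₁ : Measure (ℕ → ℝ))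
      + ENNReal.ofReal (1 - t) • (ν₂ : Measure (ℕ → ℝ))}

end MeanFieldSpherical

end

/-! The Gibbs weight on the sphere depends only on the two coordinates of a configuration along the
constant vector and along the centred field; given these, the rest is uniform on a sphere of the
orthogonal complement. The sphere of `ℝⁿ`, `n = k + 2`, is therefore parametrised by `w` in the
plane and a direction in `ℝᵏ`, via `(w + y/|y|) / √(1 + |w|²)`. In these coordinates the surface
measure is, up to a constant, `(1 + |w|²)^(-n/2) dw` times the law of the direction of a Gaussian
`y`. With `z = w / √(1 + |w|²)` one has `1 - |z|² = 1 / (1 + |w|²)`, so this density is exactly the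
`n`-th power of the entropy factor `√(1 - |z|²)`. Hence the law of `w` has density proportional to
`exp (n ψ_n(z))`, with no leftover Jacobian, where `ψ_n` is `ψ` with the sample moments in place of
`m`.

Rotation invariance realises all volumes on one probability space: `gibbsMeasure_eq_map` writes the
Gibbs state as a mixture of images of a single Gaussian sequence under `finiteTransport`. Two limits
remain. Laws of large numbers show that these images converge to `pureState`, jointly in the volume
and the parameter (`IsStronglyVarying.tendsto_finiteExpectation`). Laplace's method concentrates the
mixing law near the maximisers (`tendsto_integral_planeMeasure`).

With one maximiser the whole sequence converges. With two, the only remaining freedom is how the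
mass splits between them, and compactness of `[0, 1]` yields the weight. Opposite signs come from
concavity of the relevant upper bound for `ψ` in the variables `(x², y)`: two maximisers can differ
only by the sign of `x`. -/

noncomputable section

/-! ### Geometry of the set of maximisers. -/

namespace MeanFieldSpherical

/-- Two global maximisers agree up to the sign of their first component. -/
lemma maximizers_sq_eq {β J : ℝ} (hβ : 0 < β) (hJ : 0 < J) {m z w : ℝ × ℝ}
    (hz : z ∈ maximizers β J m) (hw : w ∈ maximizers β J m) :
    z.1 ^ 2 = w.1 ^ 2 ∧ z.2 = w.2 := by
  obtain ⟨hzd, hzm⟩ := hz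
  obtain ⟨hwd, hwm⟩ := hw
  have hval : tilting β J m z = tilting β J m w := le_antisymm (hwm z hzd) (hzm w hwd)
  simp only [disk, Set.mem_ofPred_eq] at hzd hwd
  by_contra hne
  -- The competitor `v` is the midpoint of the two maximisers in the coordinates `(x², y)`. There
  -- the quadratic and the `y` terms are linear, and `|m.1| √(x²)` is concave; choosing the sign `σ`
  -- of `m.1` for the first component turns `m.1 * x` into this concave bound.
  set u := (z.1 ^ 2 + w.1 ^ 2) / 2 with hu
  set y := (z.2 + w.2) / 2 with hy
  have hu0 : 0 ≤ u := by positivity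
  obtain ⟨σ, hσ2, hσm⟩ : ∃ σ : ℝ, σ ^ 2 = 1 ∧ σ * m.1 = |m.1| := by
    rcases le_total 0 m.1 with h | h
    · exact ⟨1, by norm_num, by rw [abs_of_nonneg h]; ring⟩
    · exact ⟨-1, by norm_num, by rw [abs_of_nonpos h]; ring⟩
  set v : ℝ × ℝ := (σ * √u, y) with hv
  have hv1 : v.1 ^ 2 = u := by simp only [hv]; rw [mul_pow, hσ2, Real.sq_sqrt hu0, one_mul]
  have hvd : v.1 ^ 2 + v.2 ^ 2 < 1 := by
    rw [hv1]; simp only [hv, hu, hy]; nlinarith [sq_nonneg (z.2 - w.2)]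
  have h1 := hzm v hvd
  have hlin : m.1 * z.1 + m.1 * w.1 ≤ 2 * (m.1 * v.1) := by
    have e : m.1 * v.1 = |m.1| * √u := by simp only [hv]; rw [← hσm]; ring
    have e2 : (z.1 + w.1) / 2 ≤ √u := by
      apply Real.le_sqrt_of_sq_le; rw [hu]; nlinarith [sq_nonneg (z.1 - w.1)]
    have e3 : -((z.1 + w.1) / 2) ≤ √u := by
      apply Real.le_sqrt_of_sq_le; rw [hu]; nlinarith [sq_nonneg (z.1 - w.1)]
    have e4 : |(z.1 + w.1) / 2| ≤ √u := abs_le'.2 ⟨e2, e3⟩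
    have e5 : m.1 * ((z.1 + w.1) / 2) ≤ |m.1| * |(z.1 + w.1) / 2| := by
      rw [← abs_mul]; exact le_abs_self _
    have e6 := mul_le_mul_of_nonneg_left e4 (abs_nonneg m.1)
    rw [e]; linarith
  set a := 1 - (z.1 ^ 2 + z.2 ^ 2) with ha
  set b := 1 - (w.1 ^ 2 + w.2 ^ 2) with hb
  set c := 1 - (v.1 ^ 2 + v.2 ^ 2) with hc
  have ha0 : 0 < a := by linarith
  have hb0 : 0 < b := by linarith
  have hc0 : 0 < c := by linarith
  have hcab : c = (a + b) / 2 + (z.2 - w.2) ^ 2 / 4 := by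
    rw [hc, hv1]; simp only [hv, hu, hy, ha, hb]; ring
  -- This is the strict gain: either `a ≠ b` and the inequality between arithmetic and geometric
  -- means is strict, or `z.2 ≠ w.2` and `c` exceeds the mean of `a` and `b`.
  have hlog : Real.log a + Real.log b < 2 * Real.log c := by
    rw [← Real.log_mul ha0.ne' hb0.ne']
    have : 2 * Real.log c = Real.log (c ^ 2) := by rw [Real.log_pow]; norm_num
    rw [this]
    apply Real.log_lt_log (by positivity)
    by_cases hy2 : z.2 = w.2
    · have hab : a ≠ b := by
        intro hab
        apply hne
        refine ⟨?_, hy2⟩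
        rw [ha, hb, hy2] at hab
        linarith
      have : 0 < (a - b) ^ 2 := by
        have := sub_ne_zero.2 hab
        positivity
      rw [hcab, hy2]
      linear_combination (1 / 4) * this
    · have h0 : 0 < (z.2 - w.2) ^ 2 := by
        have := sub_ne_zero.2 hy2
        positivity
      have : (a + b) / 2 < c := by rw [hcab]; linarith
      have hsq := pow_lt_pow_left₀ this (by positivity) two_ne_zero
      linear_combination hsq + (1 / 4) * sq_nonneg (a - b)
  have hβJ : 0 < β * J := by positivity
  have hvu : 2 * v.1 ^ 2 = z.1 ^ 2 + w.1 ^ 2 := by rw [hv1, hu]; ring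
  have hvy : 2 * v.2 = z.2 + w.2 := by simp only [hv, hy]; ring
  have hsum : tilting β J m z + tilting β J m w < 2 * tilting β J m v := by
    simp only [tilting]
    rw [← ha, ← hb, ← hc]
    have t1 : β * (m.1 * z.1 + m.1 * w.1) ≤ β * (2 * (m.1 * v.1)) :=
      mul_le_mul_of_nonneg_left hlin hβ.le
    have t2 : β * J / 2 * (2 * v.1 ^ 2) = β * J / 2 * (z.1 ^ 2 + w.1 ^ 2) := by rw [hvu]
    have t3 : β * m.2 * (2 * v.2) = β * m.2 * (z.2 + w.2) := by rw [hvy]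
    linear_combination t1 - t2 - t3 + (1 / 2) * hlog
  linarith

/-- If there are exactly two maximisers, their first components have opposite signs. -/
lemma exists_pair_of_encard_maximizers {β J : ℝ} (hβ : 0 < β) (hJ : 0 < J) {m : ℝ × ℝ}
    (h2 : (maximizers β J m).encard = 2) :
    ∃ zp zm : ℝ × ℝ, 0 < zp.1 ∧ zm.1 < 0 ∧ maximizers β J m = {zp, zm} := by
  obtain ⟨z, w, hzw, hM⟩ := Set.encard_eq_two.1 h2
  obtain ⟨h1, h2⟩ := maximizers_sq_eq hβ hJ (m := m) (z := z) (w := w)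
    (by rw [hM]; simp) (by rw [hM]; simp)
  have hneg : z.1 = -w.1 := by
    rcases sq_eq_sq_iff_eq_or_eq_neg.1 h1 with h | h
    · exact absurd (Prod.ext h h2) hzw
    · exact h
  have hw0 : w.1 ≠ 0 := by
    intro h0
    exact hzw (Prod.ext (by rw [hneg, h0, neg_zero]) h2)
  rcases lt_or_gt_of_ne hw0 with h | h
  · exact ⟨z, w, by linarith, h, hM⟩
  · exact ⟨w, z, h, by linarith, by rw [hM, Set.pair_comm]⟩

end MeanFieldSpherical

end

/-! ### Gaussian integrals, adapted orthonormal bases and polar coordinates. -/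

noncomputable section

namespace MeanFieldSpherical

open scoped ENNReal

/-- Tonelli's theorem for products of functions of one variable each. -/
lemma lintegral_fin_prod_eq_prod {n : ℕ} {μ : Fin n → Measure ℝ} [∀ i, SigmaFinite (μ i)]
    (f : Fin n → ℝ → ℝ≥0∞) (hf : ∀ i, Measurable (f i)) :
    ∫⁻ x : Fin n → ℝ, ∏ i, f i (x i) ∂(Measure.pi μ) = ∏ i, ∫⁻ x, f i x ∂(μ i) := by
  induction n with
  | zero => simp
  | succ n ih =>
    rw [← ((measurePreserving_piFinSuccAbove μ 0).symm).lintegral_comp_emb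
      (MeasurableEquiv.measurableEmbedding _)]
    simp_rw [MeasurableEquiv.piFinSuccAbove_symm_apply, Fin.insertNthEquiv,
      Fin.prod_univ_succ, Fin.insertNth_zero, Equiv.coe_fn_mk, Fin.cons_succ,
      Fin.zero_succAbove, cast_eq, Fin.cons_zero]
    have hm : Measurable fun y : Fin n → ℝ => ∏ i, f i.succ (y i) :=
      Finset.measurable_fun_prod _ fun i _ => (hf i.succ).comp (measurable_pi_apply i)
    rw [lintegral_prod_mul (f := f 0) (g := fun y : Fin n → ℝ => ∏ i, f i.succ (y i))
      (hf 0).aemeasurable hm.aemeasurable, ih _ (fun i => hf i.succ)]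

/-- The density of the standard Gaussian measure on `ℝⁿ`. -/
lemma pi_gaussianReal_eq_withDensity (n : ℕ) :
    Measure.pi (fun _ : Fin n => gaussianReal 0 1)
      = volume.withDensity fun y : Fin n → ℝ => ∏ i, gaussianPDF 0 1 (y i) := by
  refine Measure.pi_eq fun s hs => ?_
  rw [withDensity_apply _ (MeasurableSet.univ_pi hs), ← lintegral_indicator (MeasurableSet.univ_pi hs)]
  have : (Set.univ.pi s).indicator (fun y : Fin n → ℝ => ∏ i, gaussianPDF 0 1 (y i))
      = fun y => ∏ i, (s i).indicator (gaussianPDF 0 1) (y i) := by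
    ext y
    by_cases hy : y ∈ Set.univ.pi s
    · rw [Set.indicator_of_mem hy]
      exact Finset.prod_congr rfl fun i _ => (Set.indicator_of_mem (hy i trivial) _).symm
    · rw [Set.indicator_of_notMem hy]
      simp only [Set.mem_pi, Set.mem_univ, true_implies, not_forall] at hy
      obtain ⟨i, hi⟩ := hy
      exact (Finset.prod_eq_zero (Finset.mem_univ i) (Set.indicator_of_notMem hi _)).symm
  rw [this, volume_pi, lintegral_fin_prod_eq_prod]
  · refine Finset.prod_congr rfl fun i _ => ?_
    rw [lintegral_indicator (hs i), gaussianReal_of_var_ne_zero _ one_ne_zero,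
      withDensity_apply _ (hs i)]
  · exact fun i => (measurable_gaussianPDF 0 1).indicator (hs i)

/-- The Euclidean length of a tuple of real numbers. -/
def euclNorm {k : ℕ} (y : Fin k → ℝ) : ℝ := √(∑ i, y i ^ 2)

lemma measurable_euclNorm {k : ℕ} : Measurable (euclNorm (k := k)) := by
  unfold euclNorm; fun_prop

lemma euclNorm_nonneg {k : ℕ} (y : Fin k → ℝ) : 0 ≤ euclNorm y := Real.sqrt_nonneg _

lemma euclNorm_sq {k : ℕ} (y : Fin k → ℝ) : euclNorm y ^ 2 = ∑ i, y i ^ 2 :=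
  Real.sq_sqrt (Finset.sum_nonneg fun i _ => sq_nonneg (y i))

lemma euclNorm_pos {k : ℕ} {y : Fin k → ℝ} (hy : y ≠ 0) : 0 < euclNorm y := by
  rw [euclNorm, Real.sqrt_pos]
  obtain ⟨i, hi⟩ := Function.ne_iff.1 hy
  exact Finset.sum_pos' (fun i _ => sq_nonneg _) ⟨i, Finset.mem_univ i, by
    have : y i ≠ 0 := hi
    positivity⟩

lemma euclNorm_smul {k : ℕ} {c : ℝ} (hc : 0 ≤ c) (y : Fin k → ℝ) :
    euclNorm (c • y) = c * euclNorm y := by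
  simp only [euclNorm, Pi.smul_apply, smul_eq_mul, mul_pow, ← Finset.mul_sum]
  rw [Real.sqrt_mul (by positivity), Real.sqrt_sq hc]

/-- Integration against the standard Gaussian measure in terms of Lebesgue measure. -/
lemma exists_lintegral_pi_gaussianReal (k : ℕ) :
    ∃ c : ℝ≥0∞, c ≠ 0 ∧ c ≠ ∞ ∧ ∀ F : (Fin k → ℝ) → ℝ≥0∞, Measurable F →
      ∫⁻ y, ENNReal.ofReal (Real.exp (-euclNorm y ^ 2 / 2)) * F y
        = c * ∫⁻ y, F y ∂(Measure.pi fun _ : Fin k => gaussianReal 0 1) := by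
  set a : ℝ := (√(2 * Real.pi))⁻¹ with ha
  have ha0 : 0 < a := by positivity
  refine ⟨(ENNReal.ofReal (a ^ k))⁻¹, by simp, by simp [ha0], fun F hF => ?_⟩
  rw [pi_gaussianReal_eq_withDensity, lintegral_withDensity_eq_lintegral_mul _ (by fun_prop) hF,
    ← lintegral_const_mul _ (by fun_prop)]
  refine lintegral_congr fun y => ?_
  have : ∏ i, gaussianPDF 0 1 (y i)
      = ENNReal.ofReal (a ^ k) * ENNReal.ofReal (Real.exp (-euclNorm y ^ 2 / 2)) := by
    simp only [gaussianPDF]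
    rw [← ENNReal.ofReal_prod_of_nonneg (fun i _ => gaussianPDFReal_nonneg _ _ _),
      ← ENNReal.ofReal_mul (by positivity)]
    congr 1
    simp only [gaussianPDFReal, Finset.prod_mul_distrib, ← Real.exp_sum, Finset.prod_const,
      Finset.card_univ, Fintype.card_fin, NNReal.coe_one, mul_one, sub_zero, ← ha]
    rw [euclNorm_sq, ← Finset.sum_neg_distrib, Finset.sum_div]
  rw [Pi.mul_apply, this, ← mul_assoc, ← mul_assoc,
    ENNReal.inv_mul_cancel (by simp [ha0]) (by simp), one_mul]

section OrthonormalBasis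

variable {E : Type*} [NormedAddCommGroup E] [InnerProductSpace ℝ E]

/-- The linear combination of two distinguished members of a basis. -/
def planePart {k : ℕ} (b : OrthonormalBasis (Fin 2 ⊕ Fin k) ℝ E) (w : ℝ × ℝ) : E :=
  w.1 • b (.inl 0) + w.2 • b (.inl 1)

/-- The linear combination of the remaining members of a basis. -/
def perpPart {k : ℕ} (b : OrthonormalBasis (Fin 2 ⊕ Fin k) ℝ E) (y : Fin k → ℝ) : E :=
  ∑ j, y j • b (.inr j)

variable {k : ℕ} (b : OrthonormalBasis (Fin 2 ⊕ Fin k) ℝ E)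

lemma planePart_smul (c : ℝ) (w : ℝ × ℝ) : planePart b (c • w) = c • planePart b w := by
  simp [planePart, smul_smul]

lemma perpPart_smul (c : ℝ) (y : Fin k → ℝ) : perpPart b (c • y) = c • perpPart b y := by
  simp [perpPart, smul_smul, Finset.smul_sum]

lemma planePart_add_perpPart_eq (w : ℝ × ℝ) (y : Fin k → ℝ) :
    planePart b w + perpPart b y
      = b.repr.symm (WithLp.toLp 2 ((MeasurableEquiv.sumPiEquivProdPi fun _ => ℝ).symm
          (MeasurableEquiv.finTwoArrow.symm w, y))) := by
  rw [← b.sum_repr_symm]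
  simp [planePart, perpPart, MeasurableEquiv.coe_sumPiEquivProdPi_symm, Fin.sum_univ_two]

lemma norm_planePart_add_perpPart (w : ℝ × ℝ) (y : Fin k → ℝ) :
    ‖planePart b w + perpPart b y‖ = √(w.1 ^ 2 + w.2 ^ 2 + euclNorm y ^ 2) := by
  rw [planePart_add_perpPart_eq, LinearIsometryEquiv.norm_map, EuclideanSpace.norm_eq, euclNorm_sq]
  simp [MeasurableEquiv.coe_sumPiEquivProdPi_symm, Fin.sum_univ_two]

variable [MeasurableSpace E] [BorelSpace E]

@[fun_prop]
lemma measurable_planePart : Measurable (planePart b) := by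
  have : Continuous (planePart b) := by unfold planePart; fun_prop
  exact this.measurable

@[fun_prop]
lemma measurable_perpPart : Measurable (perpPart b) := by
  have : Continuous (perpPart b) := by unfold perpPart; fun_prop
  exact this.measurable

variable [FiniteDimensional ℝ E]

lemma measurePreserving_planePart_add_perpPart :
    MeasurePreserving (fun p : (ℝ × ℝ) × (Fin k → ℝ) => planePart b p.1 + perpPart b p.2)
      volume volume := by
  have h1 : MeasurePreserving (Prod.map (MeasurableEquiv.finTwoArrow (α := ℝ)).symm
      (id : (Fin k → ℝ) → _)) volume volume :=
    (volume_preserving_finTwoArrow ℝ).symm.prod (MeasurePreserving.id volume)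
  have h2 := b.measurePreserving_repr_symm.comp ((PiLp.volume_preserving_toLp (Fin 2 ⊕ Fin k)).comp
    ((volume_measurePreserving_sumPiEquivProdPi_symm fun _ : Fin 2 ⊕ Fin k => ℝ).comp h1))
  convert! h2 using 2 with p
  exact planePart_add_perpPart_eq b p.1 p.2

/-- Polar coordinates for the product of a function of the direction and one of the norm. -/
lemma lintegral_toSphere_mul [Nontrivial E] (F : E → ℝ≥0∞) (hF : Measurable F) (g : ℝ → ℝ≥0∞)
    (hg : Measurable g) :
    (∫⁻ Ω : Metric.sphere (0 : E) 1, F Ω ∂((volume : Measure E).toSphere))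
        * (∫⁻ r : Set.Ioi (0 : ℝ), g r ∂(Measure.volumeIoiPow (Module.finrank ℝ E - 1)))
      = ∫⁻ x : E, F (‖x‖⁻¹ • x) * g ‖x‖ := by
  rw [← lintegral_prod_mul (f := fun Ω : Metric.sphere (0 : E) 1 => F Ω)
    (g := fun r : Set.Ioi (0 : ℝ) => g r) (by fun_prop) (by fun_prop),
    ← (Measure.measurePreserving_homeomorphUnitSphereProd (volume : Measure E)).lintegral_comp
      (by fun_prop)]
  have h0 : MeasurableSet ({0}ᶜ : Set E) := (measurableSet_singleton 0).compl
  have := lintegral_subtype_comap (μ := (volume : Measure E)) h0 fun x => F (‖x‖⁻¹ • x) * g ‖x‖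
  simp only [homeomorphUnitSphereProd_apply_fst_coe, homeomorphUnitSphereProd_apply_snd_coe]
  rw [this, restrict_compl_singleton]

lemma lintegral_comp_smul_addHaar {V : Type*} [NormedAddCommGroup V] [NormedSpace ℝ V]
    [FiniteDimensional ℝ V] [MeasurableSpace V] [BorelSpace V] (μ : Measure V)
    [μ.IsAddHaarMeasure] {r : ℝ} (hr : 0 < r) (f : V → ℝ≥0∞) (hf : Measurable f) :
    ∫⁻ x, f x ∂μ = ENNReal.ofReal (r ^ Module.finrank ℝ V) * ∫⁻ x, f (r • x) ∂μ := by
  have h := lintegral_map (μ := μ) (g := fun x : V => r • x) hf (by fun_prop)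
  rw [← h, Measure.map_addHaar_smul μ hr.ne', lintegral_smul_measure, smul_eq_mul, ← mul_assoc,
    abs_of_pos (by positivity), ← ENNReal.ofReal_mul (by positivity),
    mul_inv_cancel₀ (by positivity), ENNReal.ofReal_one, one_mul]

end OrthonormalBasis

end MeanFieldSpherical

end

/-! ### The surface measure in plane and perpendicular coordinates. -/

noncomputable section

namespace MeanFieldSpherical

open scoped ENNReal

/-- `√(1 + |w|²)` for `w` in the plane. -/
def japaneseBracket (w : ℝ × ℝ) : ℝ := √(1 + (w.1 ^ 2 + w.2 ^ 2))

@[fun_prop]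
lemma continuous_japaneseBracket : Continuous japaneseBracket := by
  unfold japaneseBracket; fun_prop

lemma japaneseBracket_pos (w : ℝ × ℝ) : 0 < japaneseBracket w :=
  Real.sqrt_pos.2 (by positivity)

lemma japaneseBracket_sq (w : ℝ × ℝ) : japaneseBracket w ^ 2 = 1 + (w.1 ^ 2 + w.2 ^ 2) :=
  Real.sq_sqrt (by positivity)

/-- The exponent 3 exceeds the dimension 2, and higher powers decay faster because the bracket is at
least 1. The norm of `ℝ × ℝ` is the maximum norm, so it has to be compared with the Euclidean
length. -/
lemma integrable_japaneseBracket_inv_pow {n : ℕ} (hn : 3 ≤ n) :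
    Integrable fun w : ℝ × ℝ => (japaneseBracket w ^ n)⁻¹ := by
  have h := integrable_rpow_neg_one_add_norm_sq (E := ℝ × ℝ) (μ := volume) (r := 3)
    (by simp; norm_num)
  refine h.mono' (by fun_prop) (Eventually.of_forall fun w => ?_)
  have h1 : 1 ≤ japaneseBracket w := Real.one_le_sqrt.2 (by nlinarith [sq_nonneg w.1, sq_nonneg w.2])
  have h3 : (0:ℝ) < 1 + ‖w‖ ^ 2 := by positivity
  have h2 : √(1 + ‖w‖ ^ 2) ≤ japaneseBracket w := by
    apply Real.sqrt_le_sqrt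
    rcases max_choice ‖w.1‖ ‖w.2‖ with h | h <;> rw [Prod.norm_def, h, Real.norm_eq_abs, sq_abs] <;>
      nlinarith [sq_nonneg w.1, sq_nonneg w.2]
  rw [Real.norm_of_nonneg (by have := japaneseBracket_pos w; positivity)]
  calc (japaneseBracket w ^ n)⁻¹ ≤ (japaneseBracket w ^ 3)⁻¹ :=
        inv_anti₀ (by have := japaneseBracket_pos w; positivity) (pow_le_pow_right₀ h1 hn)
    _ ≤ (√(1 + ‖w‖ ^ 2) ^ 3)⁻¹ :=
        inv_anti₀ (by positivity) (pow_le_pow_left₀ (Real.sqrt_nonneg _) h2 3)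
    _ = (1 + ‖w‖ ^ 2) ^ (-(3:ℝ) / 2) := by
        rw [Real.sqrt_eq_rpow, ← Real.rpow_natCast, ← Real.rpow_mul h3.le, ← Real.rpow_neg h3.le]
        norm_num

/-- The radial weight used to pass from the sphere to the whole space. -/
def radialWeight (r : ℝ) : ℝ≥0∞ := ENNReal.ofReal ((r ^ 2)⁻¹ * Real.exp (-r ^ 2 / 2))

@[fun_prop]
lemma measurable_radialWeight : Measurable radialWeight := by
  unfold radialWeight; fun_prop

section OrthonormalBasis

variable {E : Type*} [NormedAddCommGroup E] [InnerProductSpace ℝ E] {k : ℕ} (b : OrthonormalBasis (Fin 2 ⊕ Fin k) ℝ E)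

/-- The point of the unit sphere with plane coordinates proportional to `w` and perpendicular
direction `y`. -/
def sphereParam (w : ℝ × ℝ) (y : Fin k → ℝ) : E :=
  (japaneseBracket w)⁻¹ • (planePart b w + (euclNorm y)⁻¹ • perpPart b y)

lemma sphereParam_smul (w : ℝ × ℝ) {c : ℝ} (hc : 0 < c) (y : Fin k → ℝ) :
    sphereParam b w (c • y) = sphereParam b w y := by
  rw [sphereParam, sphereParam, euclNorm_smul hc.le, perpPart_smul, smul_smul]
  congr 3
  field_simp

variable [FiniteDimensional ℝ E] [MeasurableSpace E] [BorelSpace E]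

lemma measurable_sphereParam :
    Measurable fun p : (ℝ × ℝ) × (Fin k → ℝ) => sphereParam b p.1 p.2 := by
  unfold sphereParam
  have := measurable_euclNorm (k := k)
  fun_prop

/-- The substitution `w ↦ |y| w`, with Jacobian `|y|²`, makes the norm factor as `√(1 + |w|²) |y|`.
-/
lemma lintegral_scale_plane {y : Fin k → ℝ} (hy : y ≠ 0) {F : E → ℝ≥0∞} (hF : Measurable F) :
    ∫⁻ w : ℝ × ℝ, F (‖planePart b w + perpPart b y‖⁻¹ • (planePart b w + perpPart b y))
        * radialWeight ‖planePart b w + perpPart b y‖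
      = ∫⁻ w : ℝ × ℝ, ENNReal.ofReal (euclNorm y ^ 2) * (F (sphereParam b w y)
          * radialWeight (japaneseBracket w * euclNorm y)) := by
  have hN := euclNorm_pos hy
  rw [lintegral_comp_smul_addHaar volume hN _ (by fun_prop), ← lintegral_const_mul _ (by fun_prop)]
  refine lintegral_congr fun w => ?_
  have h1 : ‖planePart b (euclNorm y • w) + perpPart b y‖ = japaneseBracket w * euclNorm y := by
    rw [norm_planePart_add_perpPart, japaneseBracket]
    nth_rw 4 [← Real.sqrt_sq hN.le]
    rw [← Real.sqrt_mul (by positivity)]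
    congr 1
    simp only [Prod.smul_fst, Prod.smul_snd, smul_eq_mul]
    ring
  have h2 : (japaneseBracket w * euclNorm y)⁻¹ • (planePart b (euclNorm y • w) + perpPart b y)
      = sphereParam b w y := by
    have hJ := (japaneseBracket_pos w).ne'
    rw [planePart_smul, sphereParam, smul_add, smul_smul, smul_add, smul_smul]
    congr 2
    · field_simp
    · field_simp
  rw [h1, h2]
  simp

/-- The substitution dividing `y` by the bracket leaves `sphereParam` unchanged and has Jacobian
equal to the bracket to the power `-k`. The factor `r⁻²` in `radialWeight` cancels `|y|²` up to two
more powers of the bracket, so that exactly the Gaussian weight survives. -/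
lemma lintegral_scale_perp (w : ℝ × ℝ) {F : E → ℝ≥0∞} (hF : Measurable F) (hk : 0 < k) :
    ∫⁻ y : Fin k → ℝ, ENNReal.ofReal (euclNorm y ^ 2) * (F (sphereParam b w y)
          * radialWeight (japaneseBracket w * euclNorm y))
      = ENNReal.ofReal (japaneseBracket w ^ (k + 2))⁻¹ * ∫⁻ y : Fin k → ℝ,
          ENNReal.ofReal (Real.exp (-euclNorm y ^ 2 / 2)) * F (sphereParam b w y) := by
  have hJ := japaneseBracket_pos w
  have hm := measurable_euclNorm (k := k)
  have hs : Measurable fun y : Fin k → ℝ => sphereParam b w y :=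
    (measurable_sphereParam b).comp (measurable_prodMk_left (x := w))
  -- Positive dimension makes the origin a null set.
  have : Nonempty (Fin k) := ⟨⟨0, hk⟩⟩
  rw [lintegral_comp_smul_addHaar volume (inv_pos.2 hJ) _ (by fun_prop),
    ← lintegral_const_mul _ (by fun_prop), ← lintegral_const_mul _ (by fun_prop)]
  have hae : ∀ᵐ y : Fin k → ℝ, y ≠ 0 := by simp [ae_iff]
  refine lintegral_congr_ae (hae.mono fun y hy => ?_)
  have hN := euclNorm_pos hy
  simp only
  rw [sphereParam_smul b w (inv_pos.2 hJ), euclNorm_smul (inv_pos.2 hJ).le, radialWeight,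
    mul_comm (F _), ← mul_assoc, ← mul_assoc, ← mul_assoc, ← ENNReal.ofReal_mul (by positivity),
    ← ENNReal.ofReal_mul (by positivity), ← mul_assoc (ENNReal.ofReal _),
    ← ENNReal.ofReal_mul (by positivity)]
  congr 2
  rw [mul_inv_cancel₀ hJ.ne', one_mul, Module.finrank_fin_fun, pow_add, mul_inv, mul_pow, inv_pow,
    inv_pow]
  field_simp

/-- The surface measure of the unit sphere in the coordinates `sphereParam`. -/
theorem exists_lintegral_toSphere_eq (hk : 0 < k) :
    ∃ c : ℝ≥0∞, c ≠ 0 ∧ c ≠ ∞ ∧ ∀ F : E → ℝ≥0∞, Measurable F →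
      ∫⁻ Ω : Metric.sphere (0 : E) 1, F Ω ∂((volume : Measure E).toSphere)
        = c * ∫⁻ w : ℝ × ℝ, ENNReal.ofReal (japaneseBracket w ^ (k + 2))⁻¹ *
          ∫⁻ y, F (sphereParam b w y) ∂(Measure.pi fun _ : Fin k => gaussianReal 0 1) := by
  obtain ⟨d, hd0, hdtop, hd⟩ := exists_lintegral_pi_gaussianReal k
  set C := ∫⁻ r : Set.Ioi (0 : ℝ), radialWeight r
    ∂(Measure.volumeIoiPow (Module.finrank ℝ E - 1)) with hC
  have : Nonempty (Fin k) := ⟨⟨0, hk⟩⟩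
  have hnt : Nontrivial E := ⟨b (.inl 0), 0, b.orthonormal.ne_zero _⟩
  have hm := measurable_euclNorm (k := k)
  have hs := measurable_sphereParam b
  have key : ∀ F : E → ℝ≥0∞, Measurable F →
      (∫⁻ Ω : Metric.sphere (0 : E) 1, F Ω ∂((volume : Measure E).toSphere)) * C
        = d * ∫⁻ w : ℝ × ℝ, ENNReal.ofReal (japaneseBracket w ^ (k + 2))⁻¹ *
          ∫⁻ y, F (sphereParam b w y) ∂(Measure.pi fun _ : Fin k => gaussianReal 0 1) := by
    intro F hF
    rw [hC, lintegral_toSphere_mul F hF radialWeight (by fun_prop),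
      ← (measurePreserving_planePart_add_perpPart b).lintegral_comp (by fun_prop),
      Measure.volume_eq_prod, lintegral_prod_symm _ (by fun_prop)]
    have hae : ∀ᵐ y : Fin k → ℝ, y ≠ 0 := by simp [ae_iff]
    -- First `w` is rescaled for fixed `y`; after exchanging the integrals, `y` is rescaled for
    -- fixed `w`.
    rw [lintegral_congr_ae (hae.mono fun y hy => lintegral_scale_plane b hy hF),
      lintegral_lintegral_swap (by fun_prop)]
    simp_rw [lintegral_scale_perp b _ hF hk]
    rw [← lintegral_const_mul _ (by fun_prop)]
    refine lintegral_congr fun w => ?_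
    rw [hd (fun y => F (sphereParam b w y)) (by fun_prop)]
    ring
  -- Testing with the constant 1 shows that the radial integral `C` is neither zero nor infinite,
  -- without evaluating it.
  have hk1 := key 1 measurable_one
  simp only [Pi.one_apply, lintegral_one, measure_univ, mul_one] at hk1
  have hI := (integrable_japaneseBracket_inv_pow (n := k + 2) (by omega)).lintegral_lt_top
  have hI0 : ∫⁻ w : ℝ × ℝ, ENNReal.ofReal (japaneseBracket w ^ (k + 2))⁻¹ ≠ 0 := by
    refine ((lintegral_pos_iff_support (by fun_prop)).2 ?_).ne'
    have : Function.support (fun w : ℝ × ℝ => ENNReal.ofReal (japaneseBracket w ^ (k + 2))⁻¹)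
        = Set.univ := by
      ext w
      have := japaneseBracket_pos w
      simp only [Function.mem_support, Set.mem_univ, iff_true]
      exact (ENNReal.ofReal_pos.2 (by positivity)).ne'
    rw [this]
    simp
  have hσ0 : (volume : Measure E).toSphere Set.univ ≠ 0 :=
    Measure.measure_univ_ne_zero.2 (Measure.toSphere_ne_zero _)
  have hσtop := measure_ne_top (volume : Measure E).toSphere Set.univ
  have hC0 : C ≠ 0 := by
    intro h
    rw [h, mul_zero] at hk1
    exact (mul_ne_zero hd0 hI0) hk1.symm
  have hCtop : C ≠ ∞ := by
    intro h
    rw [h, ENNReal.mul_top hσ0] at hk1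
    exact (ENNReal.mul_ne_top hdtop hI.ne) hk1.symm
  refine ⟨d * C⁻¹, mul_ne_zero hd0 (ENNReal.inv_ne_zero.2 hCtop),
    ENNReal.mul_ne_top hdtop (ENNReal.inv_ne_top.2 hC0), fun F hF => ?_⟩
  rw [mul_right_comm, ← key F hF, mul_assoc, ENNReal.mul_inv_cancel hC0 hCtop, mul_one]

end OrthonormalBasis

end MeanFieldSpherical

end

/-! ### The plane spanned by the constants and the field, and the tilting function on it. -/

noncomputable section

namespace MeanFieldSpherical

open scoped ENNReal RealInnerProductSpace

/-- The normalised constant vector of `ℝⁿ`. -/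
def unitOnes (n : ℕ) : EuclideanSpace ℝ (Fin n) := WithLp.toLp 2 fun _ => 1 / √n

/-- The normalised centred field in `ℝⁿ`. -/
def unitField (h : ℕ → ℝ) (n : ℕ) : EuclideanSpace ℝ (Fin n) :=
  WithLp.toLp 2 fun i => (h i - sampleMean h n) / (√n * sampleStd h n)

lemma inner_unitOnes {n : ℕ} (x : EuclideanSpace ℝ (Fin n)) :
    ⟪unitOnes n, x⟫ = (∑ i, x i) / √n := by
  rw [PiLp.inner_apply, Finset.sum_div]
  refine Finset.sum_congr rfl fun i _ => ?_
  simp [unitOnes, div_eq_mul_inv]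

lemma inner_unitField (h : ℕ → ℝ) {n : ℕ} (x : EuclideanSpace ℝ (Fin n)) :
    ⟪unitField h n, x⟫ = (∑ i, x i * (h i - sampleMean h n)) / (√n * sampleStd h n) := by
  rw [PiLp.inner_apply, Finset.sum_div]
  refine Finset.sum_congr rfl fun i _ => ?_
  simp [unitField, mul_div_assoc]

lemma sum_sub_sampleMean (h : ℕ → ℝ) {n : ℕ} (hn : n ≠ 0) :
    ∑ i : Fin n, (h i - sampleMean h n) = 0 := by
  have : (n : ℝ) ≠ 0 := Nat.cast_ne_zero.2 hn
  rw [Finset.sum_sub_distrib, ← Finset.sum_range fun i => h i, sampleMean]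
  simp
  field_simp
  ring

lemma sum_sub_sampleMean_sq (h : ℕ → ℝ) {n : ℕ} (hn : n ≠ 0) (hσ : 0 < sampleStd h n) :
    ∑ i : Fin n, (h i - sampleMean h n) ^ 2 = n * sampleStd h n ^ 2 := by
  have hn' : (n : ℝ) ≠ 0 := Nat.cast_ne_zero.2 hn
  rw [sampleStd] at hσ
  rw [sampleStd, Real.sq_sqrt (Real.sqrt_pos.1 hσ).le]
  have : ∀ i : Fin n, (h i - sampleMean h n) ^ 2
      = h i ^ 2 - 2 * sampleMean h n * (h i - sampleMean h n) - sampleMean h n ^ 2 :=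
    fun i => by ring
  simp_rw [this, Finset.sum_sub_distrib, ← Finset.mul_sum, sum_sub_sampleMean h hn]
  rw [← Finset.sum_range fun i => h i ^ 2]
  simp
  field_simp

lemma norm_unitOnes {n : ℕ} (hn : n ≠ 0) : ‖unitOnes n‖ = 1 := by
  have hn' : (0:ℝ) < n := Nat.cast_pos.2 (Nat.pos_of_ne_zero hn)
  rw [EuclideanSpace.norm_eq, Real.sqrt_eq_one]
  simp [unitOnes, hn'.ne']

lemma norm_unitField (h : ℕ → ℝ) {n : ℕ} (hn : n ≠ 0) (hσ : 0 < sampleStd h n) :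
    ‖unitField h n‖ = 1 := by
  have hn' : (0:ℝ) < n := Nat.cast_pos.2 (Nat.pos_of_ne_zero hn)
  rw [EuclideanSpace.norm_eq, Real.sqrt_eq_one]
  simp only [unitField, Real.norm_eq_abs, sq_abs, div_pow]
  rw [← Finset.sum_div, sum_sub_sampleMean_sq h hn hσ, mul_pow, Real.sq_sqrt hn'.le]
  have := hσ.ne'
  field_simp

lemma inner_unitOnes_unitField (h : ℕ → ℝ) {n : ℕ} (hn : n ≠ 0) :
    ⟪unitOnes n, unitField h n⟫ = 0 := by
  rw [inner_unitOnes]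
  simp only [unitField]
  rw [← Finset.sum_div, sum_sub_sampleMean h hn]
  simp

lemma exists_basis_unitOnes_unitField (h : ℕ → ℝ) {k : ℕ} (hσ : 0 < sampleStd h (k + 2)) :
    ∃ b : OrthonormalBasis (Fin 2 ⊕ Fin k) ℝ (EuclideanSpace ℝ (Fin (k + 2))),
      b (.inl 0) = unitOnes (k + 2) ∧ b (.inl 1) = unitField h (k + 2) := by
  set v : Fin 2 ⊕ Fin k → EuclideanSpace ℝ (Fin (k + 2)) :=
    Sum.elim ![unitOnes (k + 2), unitField h (k + 2)] 0 with hv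
  have h12 := inner_unitOnes_unitField h (n := k + 2) (by omega)
  have hor : Orthonormal ℝ ((Set.range Sum.inl).domRestrict v) := by
    refine ⟨?_, ?_⟩
    · rintro ⟨_, i, rfl⟩
      fin_cases i
      · exact norm_unitOnes (by omega)
      · exact norm_unitField h (by omega) hσ
    · rintro ⟨_, i, rfl⟩ ⟨_, j, rfl⟩ hij
      fin_cases i <;> fin_cases j
      · exact absurd rfl hij
      · exact h12
      · exact (real_inner_comm _ _).trans h12
      · exact absurd rfl hij
  obtain ⟨b, hb⟩ := hor.exists_orthonormalBasis_extension_of_card_eq (by simp [add_comm])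
  exact ⟨b, hb _ ⟨0, rfl⟩, hb _ ⟨1, rfl⟩⟩

/-- The exponential weight depends only on the two distinguished coordinates. -/
lemma neg_mul_hamiltonian (β J : ℝ) (h : ℕ → ℝ) {n : ℕ} (hn : n ≠ 0) (hσ : 0 < sampleStd h n)
    (x : EuclideanSpace ℝ (Fin n)) :
    -β * hamiltonian J h n (√(n : ℝ) • x)
      = n * (β * J / 2 * ⟪unitOnes n, x⟫ ^ 2
          + β * (sampleMean h n * ⟪unitOnes n, x⟫ + sampleStd h n * ⟪unitField h n, x⟫)) := by
  have hn' : (0:ℝ) < n := Nat.cast_pos.2 (Nat.pos_of_ne_zero hn)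
  have hs : 0 < √(n : ℝ) := Real.sqrt_pos.2 hn'
  have hss : √(n : ℝ) ^ 2 = n := Real.sq_sqrt hn'.le
  rw [inner_unitOnes, inner_unitField]
  simp only [mul_sub, Finset.sum_sub_distrib, ← Finset.sum_mul]
  simp only [hamiltonian, PiLp.smul_apply, smul_eq_mul]
  have h1 : ∑ i, ∑ j, √(n : ℝ) * x i * (√(n : ℝ) * x j) = n * (∑ i, x i) ^ 2 := by
    rw [sq (∑ i, x i), Finset.sum_mul_sum, Finset.mul_sum]
    refine Finset.sum_congr rfl fun i _ => ?_
    rw [Finset.mul_sum]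
    exact Finset.sum_congr rfl fun j _ => by linear_combination x i * x j * hss
  have h2 : ∑ i : Fin n, h i * (√(n : ℝ) * x i) = √(n : ℝ) * ∑ i, x i * h i := by
    rw [Finset.mul_sum]
    exact Finset.sum_congr rfl fun j _ => by ring
  rw [h1, h2]
  generalize ∑ i, x i = S
  generalize ∑ i : Fin n, x i * h i = T
  generalize √(n : ℝ) = r at *
  generalize (n : ℝ) = N at *
  subst hss
  field_simp
  ring

/-- The coordinate in the unit disk belonging to `w`. -/
def diskPoint (w : ℝ × ℝ) : ℝ × ℝ := (w.1 / japaneseBracket w, w.2 / japaneseBracket w)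

@[fun_prop]
lemma continuous_diskPoint : Continuous diskPoint := by
  unfold diskPoint
  have := fun w => (japaneseBracket_pos w).ne'
  fun_prop (disch := assumption)

/-- This identity turns the entropy term of `tilting` into minus the logarithm of the bracket, hence
the surface density into part of `exp (n ψ)`. -/
lemma one_sub_diskPoint (w : ℝ × ℝ) :
    1 - ((diskPoint w).1 ^ 2 + (diskPoint w).2 ^ 2) = (japaneseBracket w ^ 2)⁻¹ := by
  have h0 := (japaneseBracket_pos w).ne'
  have h1 := japaneseBracket_sq w
  simp only [diskPoint, div_pow]
  field_simp
  linarith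

/-- The tilting function in the coordinates of the plane. -/
def planeTilting (β J : ℝ) (m w : ℝ × ℝ) : ℝ := tilting β J m (diskPoint w)

lemma planeTilting_eq (β J : ℝ) (m w : ℝ × ℝ) :
    planeTilting β J m w = β * J / 2 * (diskPoint w).1 ^ 2
      + β * (m.1 * (diskPoint w).1 + m.2 * (diskPoint w).2) - Real.log (japaneseBracket w) := by
  rw [planeTilting, tilting, one_sub_diskPoint, Real.log_inv, Real.log_pow]
  push_cast
  ring

@[fun_prop]
lemma continuous_planeTilting (β J : ℝ) (m : ℝ × ℝ) : Continuous (planeTilting β J m) := by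
  rw [funext (planeTilting_eq β J m)]
  have := fun w => (japaneseBracket_pos w).ne'
  fun_prop (disch := assumption)

lemma exp_mul_planeTilting (β J : ℝ) (m w : ℝ × ℝ) (n : ℕ) :
    Real.exp (n * planeTilting β J m w) = (japaneseBracket w ^ n)⁻¹ *
      Real.exp (n * (β * J / 2 * (diskPoint w).1 ^ 2
        + β * (m.1 * (diskPoint w).1 + m.2 * (diskPoint w).2))) := by
  rw [planeTilting_eq, mul_sub, Real.exp_sub, mul_comm (n : ℝ) (Real.log _), Real.exp_mul (Real.log _),
    Real.exp_log (japaneseBracket_pos w), Real.rpow_natCast]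
  ring

lemma abs_diskPoint_le (w : ℝ × ℝ) : |(diskPoint w).1| ≤ 1 ∧ |(diskPoint w).2| ≤ 1 := by
  have h := one_sub_diskPoint w
  have h0 : 0 < (japaneseBracket w ^ 2)⁻¹ := by have := japaneseBracket_pos w; positivity
  constructor <;> apply abs_le_one_iff_mul_self_le_one.2 <;>
    nlinarith [sq_nonneg (diskPoint w).1, sq_nonneg (diskPoint w).2]

lemma exponent_le (β J : ℝ) (m w : ℝ × ℝ) :
    β * J / 2 * (diskPoint w).1 ^ 2 + β * (m.1 * (diskPoint w).1 + m.2 * (diskPoint w).2)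
      ≤ |β * J / 2| + |β| * (|m.1| + |m.2|) := by
  obtain ⟨h1, h2⟩ := abs_diskPoint_le w
  refine add_le_add ((le_abs_self _).trans ?_) ((le_abs_self _).trans ?_)
  · rw [abs_mul, abs_pow]
    exact mul_le_of_le_one_right (abs_nonneg _) (pow_le_one₀ (abs_nonneg _) h1)
  · rw [abs_mul]
    refine mul_le_mul_of_nonneg_left ((abs_add_le _ _).trans ?_) (abs_nonneg _)
    rw [abs_mul, abs_mul]
    exact add_le_add (mul_le_of_le_one_right (abs_nonneg _) h1)
      (mul_le_of_le_one_right (abs_nonneg _) h2)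

lemma integrable_exp_planeTilting (β J : ℝ) (m : ℝ × ℝ) {n : ℕ} (hn : 3 ≤ n) :
    Integrable fun w => Real.exp (n * planeTilting β J m w) := by
  have hc : Continuous fun w => Real.exp (n * planeTilting β J m w) := by fun_prop
  refine ((integrable_japaneseBracket_inv_pow hn).mul_const
    (Real.exp (n * (|β * J / 2| + (|β| * (|m.1| + |m.2|)))))).mono' hc.aestronglyMeasurable
    (Eventually.of_forall fun w => ?_)
  rw [Real.norm_of_nonneg (Real.exp_pos _).le, exp_mul_planeTilting]
  have := japaneseBracket_pos w
  have := exponent_le β J m w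
  gcongr

end MeanFieldSpherical

end

/-! ### Realising the perpendicular direction by one Gaussian sequence for all volumes. -/

noncomputable section

namespace MeanFieldSpherical

open scoped ENNReal RealInnerProductSpace

/-- The standardised field. -/
def stdField (h : ℕ → ℝ) (n i : ℕ) : ℝ := (h i - sampleMean h n) / sampleStd h n

/-- The part of the first `n` components of `g` orthogonal to the constants and to the field. -/
def perpField (h : ℕ → ℝ) (n : ℕ) (g : ℕ → ℝ) (i : ℕ) : ℝ :=
  g i - (∑ j ∈ Finset.range n, g j) / n
    - (∑ j ∈ Finset.range n, g j * stdField h n j) / n * stdField h n i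

/-- The finite-volume analogue of the affine map `transport`. -/
def finiteTransport (h : ℕ → ℝ) (n : ℕ) (z : ℝ × ℝ) (g : ℕ → ℝ) : ℕ → ℝ := fun i =>
  if i < n then z.1 + z.2 * stdField h n i + √(1 - (z.1 ^ 2 + z.2 ^ 2)) *
    (√n * (perpField h n g i / √(∑ j ∈ Finset.range n, perpField h n g j ^ 2))) else 0

@[fun_prop]
lemma measurable_perpField (h : ℕ → ℝ) (n : ℕ) : Measurable (perpField h n) := by
  unfold perpField; fun_prop

lemma measurable_finiteTransport (h : ℕ → ℝ) (n : ℕ) :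
    Measurable fun p : (ℝ × ℝ) × (ℕ → ℝ) => finiteTransport h n p.1 p.2 := by
  refine measurable_pi_lambda _ fun i => ?_
  by_cases hi : i < n
  · simp only [finiteTransport, hi, if_true]
    have hm : ∀ j, Measurable fun g => perpField h n g j := fun j =>
      (measurable_pi_apply j).comp (measurable_perpField h n)
    fun_prop
  · simp only [finiteTransport, hi, if_false]
    fun_prop

/-- `perpField` as a vector of `ℝⁿ`. -/
def perpVec (h : ℕ → ℝ) (n : ℕ) (g : ℕ → ℝ) : EuclideanSpace ℝ (Fin n) :=
  WithLp.toLp 2 fun i => perpField h n g i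

/-- The empirical averages in `perpField` are orthogonal projections: each factor `1/n` splits into
two factors `1/√n`, one for each occurrence of the unit vector. -/
lemma perpVec_eq (h : ℕ → ℝ) (n : ℕ) (g : ℕ → ℝ) (x : EuclideanSpace ℝ (Fin n))
    (hx : ∀ i, x i = g i) :
    perpVec h n g = x - ⟪unitOnes n, x⟫ • unitOnes n - ⟪unitField h n, x⟫ • unitField h n := by
  ext i
  have hs : √(n : ℝ) * √(n : ℝ) = n := Real.mul_self_sqrt (Nat.cast_nonneg n)
  have h1 : (∑ j ∈ Finset.range n, g j) / n = (∑ j, x j) / √n * (1 / √n) := by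
    rw [Finset.sum_range, div_mul_div_comm, mul_one, hs]
    simp only [hx]
  have h2 : (∑ j ∈ Finset.range n, g j * stdField h n j) / n * stdField h n i
      = (∑ j, x j * (h j - sampleMean h n)) / (√n * sampleStd h n)
        * ((h i - sampleMean h n) / (√n * sampleStd h n)) := by
    simp only [hx, stdField]
    rw [← Finset.sum_range fun j => g j * (h j - sampleMean h n)]
    simp_rw [← mul_div_assoc]
    rw [← Finset.sum_div]
    generalize ∑ j ∈ Finset.range n, g j * (h j - sampleMean h n) = S
    have hsi : (n : ℝ)⁻¹ = (√(n : ℝ))⁻¹ * (√(n : ℝ))⁻¹ := by rw [← mul_inv, hs]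
    simp only [div_eq_mul_inv, mul_inv, hsi]
    ring
  rw [inner_unitOnes, inner_unitField]
  simp only [perpVec, perpField, unitOnes, unitField, PiLp.sub_apply, PiLp.smul_apply, smul_eq_mul]
  rw [h1, h2, hx]

lemma map_standardGaussian_toLp (n : ℕ) :
    standardGaussian.map (fun g => WithLp.toLp 2 fun i : Fin n => g i)
      = stdGaussian (EuclideanSpace ℝ (Fin n)) := by
  have h : standardGaussian.map (fun g => fun i : Fin n => g i)
      = Measure.pi fun _ : Fin n => gaussianReal 0 1 := by
    refine (Measure.pi_eq fun s hs => ?_).symm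
    rw [Measure.map_apply (by fun_prop) (MeasurableSet.univ_pi hs)]
    have he : (fun g : ℕ → ℝ => fun i : Fin n => g i) ⁻¹' Set.univ.pi s
        = Set.pi (Finset.range n : Finset ℕ)
          fun i => if hi : i < n then s ⟨i, hi⟩ else Set.univ := by
      ext g
      simp only [Set.mem_preimage, Set.mem_pi, Set.mem_univ, true_implies, Finset.coe_range,
        Set.mem_Iio]
      constructor
      · intro H i hi
        rw [dif_pos hi]
        exact H ⟨i, hi⟩
      · intro H i
        have := H i i.2
        rwa [dif_pos i.2] at this
    rw [he, standardGaussian, Measure.infinitePi_pi, Finset.prod_range]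
    · exact Finset.prod_congr rfl fun i _ => by rw [dif_pos i.2]
    · intro i hi
      rw [dif_pos (Finset.mem_range.1 hi)]
      exact hs _
  rw [← map_pi_eq_stdGaussian, ← h, Measure.map_map (by fun_prop) (by fun_prop)]
  rfl

lemma norm_perpPart {E : Type*} [NormedAddCommGroup E] [InnerProductSpace ℝ E] {k : ℕ}
    (b : OrthonormalBasis (Fin 2 ⊕ Fin k) ℝ E) (y : Fin k → ℝ) :
    ‖perpPart b y‖ = euclNorm y := by
  have := norm_planePart_add_perpPart b 0 y
  simpa [planePart, Real.sqrt_sq (euclNorm_nonneg y)] using this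

lemma inner_planePart_perpPart {E : Type*} [NormedAddCommGroup E] [InnerProductSpace ℝ E] {k : ℕ}
    (b : OrthonormalBasis (Fin 2 ⊕ Fin k) ℝ E) (y : Fin k → ℝ) (i : Fin 2) :
    ⟪b (.inl i), perpPart b y⟫ = 0 := by
  simp only [perpPart, inner_sum, inner_smul_right]
  exact Finset.sum_eq_zero fun j _ => by rw [b.inner_eq_zero (by simp), mul_zero]

lemma inner_sphereParam {E : Type*} [NormedAddCommGroup E] [InnerProductSpace ℝ E] {k : ℕ}
    (b : OrthonormalBasis (Fin 2 ⊕ Fin k) ℝ E) (w : ℝ × ℝ) (y : Fin k → ℝ) :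
    ⟪b (.inl 0), sphereParam b w y⟫ = (diskPoint w).1 ∧
      ⟪b (.inl 1), sphereParam b w y⟫ = (diskPoint w).2 := by
  have h00 : ⟪b (.inl 0), b (.inl 0)⟫ = 1 := b.inner_eq_one _
  have h11 : ⟪b (.inl 1), b (.inl 1)⟫ = 1 := b.inner_eq_one _
  have h01 : ⟪b (.inl 0), b (.inl 1)⟫ = 0 := b.inner_eq_zero (by simp)
  have h10 : ⟪b (.inl 1), b (.inl 0)⟫ = 0 := b.inner_eq_zero (by simp)
  constructor <;>
  · simp only [sphereParam, planePart, inner_smul_right, inner_add_right, inner_planePart_perpPart,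
      h00, h11, h01, h10, diskPoint]
    ring

section

variable {h : ℕ → ℝ} {k : ℕ}
  {b : OrthonormalBasis (Fin 2 ⊕ Fin k) ℝ (EuclideanSpace ℝ (Fin (k + 2)))}

/-- The law of the perpendicular part of a standard Gaussian vector. -/
lemma lintegral_perpPart (hb0 : b (.inl 0) = unitOnes (k + 2))
    (hb1 : b (.inl 1) = unitField h (k + 2)) (H : EuclideanSpace ℝ (Fin (k + 2)) → ℝ≥0∞)
    (hH : Measurable H) :
    ∫⁻ y, H (perpPart b y) ∂(Measure.pi fun _ : Fin k => gaussianReal 0 1)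
      = ∫⁻ g, H (perpVec h (k + 2) g) ∂standardGaussian := by
  set P : EuclideanSpace ℝ (Fin (k + 2)) → EuclideanSpace ℝ (Fin (k + 2)) := fun x =>
    x - ⟪b (.inl 0), x⟫ • b (.inl 0) - ⟪b (.inl 1), x⟫ • b (.inl 1) with hP
  have hPm : Measurable P := by fun_prop
  have h1 : ∫⁻ g, H (perpVec h (k + 2) g) ∂standardGaussian
      = ∫⁻ x, H (P x) ∂(stdGaussian (EuclideanSpace ℝ (Fin (k + 2)))) := by
    rw [← map_standardGaussian_toLp, lintegral_map (by fun_prop) (by fun_prop)]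
    refine lintegral_congr fun g => ?_
    rw [perpVec_eq h _ g (WithLp.toLp 2 fun i : Fin (k + 2) => g i) fun i => rfl, hP]
    simp only [hb0, hb1]
  -- Rotation invariance: the coordinates in the basis `b` are again independent standard Gaussians,
  -- and `P` discards the first two.
  rw [h1, stdGaussian_eq_map_pi_orthonormalBasis b, lintegral_map (by fun_prop) (by fun_prop)]
  have h2 : ∀ x : Fin 2 ⊕ Fin k → ℝ, P (∑ i, x i • b i) = perpPart b fun j => x (.inr j) := by
    intro x
    have hi : ∀ i, ⟪b i, ∑ j, x j • b j⟫ = x i := fun i => by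
      rw [b.orthonormal.inner_right_fintype]
    simp only [hP, hi]
    rw [Fintype.sum_sum_type, Fin.sum_univ_two, perpPart]
    abel
  simp only [h2]
  have h3 := (measurePreserving_sumPiEquivProdPi fun _ : Fin 2 ⊕ Fin k => gaussianReal 0 1).lintegral_comp
    (f := fun p => H (perpPart b p.2)) (by fun_prop)
  rw [lintegral_prod _ (by fun_prop)] at h3
  simp only [lintegral_const, measure_univ, mul_one] at h3
  rw [← h3]
  rfl

/-- The radius `√n` cancels the normalisation of the two unit vectors, and the inverse bracket is
`√(1 - |z|²)`. -/
lemma zeroExtend_sphereParam (hb0 : b (.inl 0) = unitOnes (k + 2))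
    (hb1 : b (.inl 1) = unitField h (k + 2)) (w : ℝ × ℝ) (g : ℕ → ℝ) :
    zeroExtend (k + 2) (√((k + 2 : ℕ) : ℝ) • ((japaneseBracket w)⁻¹ •
        (planePart b w + ‖perpVec h (k + 2) g‖⁻¹ • perpVec h (k + 2) g)))
      = finiteTransport h (k + 2) (diskPoint w) g := by
  ext i
  by_cases hi : i < k + 2
  · have hn : (0 : ℝ) < √((k + 2 : ℕ) : ℝ) := Real.sqrt_pos.2 (by positivity)
    have hJ := japaneseBracket_pos w
    have hnorm : ‖perpVec h (k + 2) g‖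
        = √(∑ j ∈ Finset.range (k + 2), perpField h (k + 2) g j ^ 2) := by
      rw [EuclideanSpace.norm_eq, Finset.sum_range]
      simp [perpVec]
    rw [zeroExtend, dif_pos hi, finiteTransport, if_pos hi, one_sub_diskPoint, Real.sqrt_inv,
      Real.sqrt_sq hJ.le, hnorm]
    simp only [planePart, hb0, hb1, perpVec, unitOnes, unitField, stdField, PiLp.smul_apply,
      PiLp.add_apply, smul_eq_mul, diskPoint]
    generalize √(∑ j ∈ Finset.range (k + 2), perpField h (k + 2) g j ^ 2) = N
    generalize √((k + 2 : ℕ) : ℝ) = r at *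
    generalize japaneseBracket w = s at *
    simp only [div_eq_mul_inv, mul_inv]
    have hr : r * r⁻¹ = 1 := mul_inv_cancel₀ hn.ne'
    linear_combination (s⁻¹ * (w.1 + w.2 * (h i - sampleMean h (k + 2)) *
      (sampleStd h (k + 2))⁻¹)) * hr
  · simp [zeroExtend, finiteTransport, hi]

end

end MeanFieldSpherical

end

/-! ### The finite-volume Gibbs state as a mixture. -/

noncomputable section

namespace MeanFieldSpherical

open scoped ENNReal RealInnerProductSpace

/-- The sample mean and the sample standard deviation as a pair. -/
def sampleMoments (h : ℕ → ℝ) (n : ℕ) : ℝ × ℝ := (sampleMean h n, sampleStd h n)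

/-- The law of the plane coordinates under the finite-volume Gibbs state. -/
def planeMeasure (β J : ℝ) (h : ℕ → ℝ) (n : ℕ) : Measure (ℝ × ℝ) :=
  volume.tilted fun w => n * planeTilting β J (sampleMoments h n) w

lemma isProbabilityMeasure_planeMeasure (β J : ℝ) (h : ℕ → ℝ) {n : ℕ} (hn : 3 ≤ n) :
    IsProbabilityMeasure (planeMeasure β J h n) :=
  isProbabilityMeasure_tilted (integrable_exp_planeTilting β J _ hn)

/-- The finite-volume Gibbs state is a mixture of images of the standard Gaussian measure. -/
theorem gibbsMeasure_eq_map (β J : ℝ) (h : ℕ → ℝ) {n : ℕ} (hn : 3 ≤ n) (hσ : 0 < sampleStd h n) :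
    gibbsMeasure β J h n = ((planeMeasure β J h n).prod standardGaussian).map
      fun p => finiteTransport h n (diskPoint p.1) p.2 := by
  obtain ⟨k, rfl⟩ : ∃ k, n = k + 2 := ⟨n - 2, by omega⟩
  obtain ⟨b, hb0, hb1⟩ := exists_basis_unitOnes_unitField h hσ
  obtain ⟨c, hc0, hctop, hc⟩ := exists_lintegral_toSphere_eq b (by omega)
  have hP := isProbabilityMeasure_planeMeasure β J h hn
  have hG : IsProbabilityMeasure (gibbsMeasure β J h (k + 2)) :=
    isProbabilityMeasure_gibbsMeasure β J h ⟨k + 2, by omega⟩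
  have hTm : Measurable fun p : (ℝ × ℝ) × (ℕ → ℝ) =>
      finiteTransport h (k + 2) (diskPoint p.1) p.2 :=
    (measurable_finiteTransport h (k + 2)).comp
      (f := fun p : (ℝ × ℝ) × (ℕ → ℝ) => (diskPoint p.1, p.2)) (by fun_prop)
  have hHc := continuous_hamiltonian J h (k + 2)
  have hze := (continuous_zeroExtend (k + 2)).measurable
  set Z := ∫ Ω : Metric.sphere (0 : EuclideanSpace ℝ (Fin (k + 2))) 1,
    Real.exp (-β * hamiltonian J h (k + 2) (√((k + 2 : ℕ) : ℝ) •
      (Ω : EuclideanSpace ℝ (Fin (k + 2))))) ∂(volume.toSphere) with hZ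
  set Z' := ∫ w, Real.exp ((k + 2 : ℕ) * planeTilting β J (sampleMoments h (k + 2)) w) with hZ'
  have hZ'0 : 0 < Z' := integral_exp_pos (integrable_exp_planeTilting β J _ hn)
  have hZ0 : 0 ≤ Z := integral_nonneg fun _ => (Real.exp_pos _).le
  -- the two measures are proportional
  have key : ∀ f : (ℕ → ℝ) → ℝ≥0∞, Measurable f →
      ∫⁻ φ, f φ ∂(gibbsMeasure β J h (k + 2))
        = c * ENNReal.ofReal (Z' / Z) * ∫⁻ φ, f φ ∂(((planeMeasure β J h (k + 2)).prod
          standardGaussian).map fun p => finiteTransport h (k + 2) (diskPoint p.1) p.2) := by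
    intro f hf
    rw [gibbsMeasure, lintegral_map hf (by fun_prop), sphereGibbs, lintegral_tilted,
      hc (fun x => ENNReal.ofReal (Real.exp (-β * hamiltonian J h (k + 2)
        (√((k + 2 : ℕ) : ℝ) • x)) / Z) * f (zeroExtend (k + 2) (√((k + 2 : ℕ) : ℝ) • x)))
        (by fun_prop), lintegral_map hf hTm, lintegral_prod (fun p =>
        f (finiteTransport h (k + 2) (diskPoint p.1) p.2)) (hf.comp hTm).aemeasurable, planeMeasure,
      lintegral_tilted, mul_assoc]
    congr 1
    rw [← lintegral_const_mul' _ _ ENNReal.ofReal_ne_top]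
    refine lintegral_congr fun w => ?_
    have hF : ∀ y : Fin k → ℝ, ENNReal.ofReal (Real.exp (-β * hamiltonian J h (k + 2)
          (√((k + 2 : ℕ) : ℝ) • sphereParam b w y)) / Z)
        = ENNReal.ofReal (Real.exp ((k + 2 : ℕ) * (β * J / 2 * (diskPoint w).1 ^ 2
          + β * (sampleMean h (k + 2) * (diskPoint w).1
            + sampleStd h (k + 2) * (diskPoint w).2))) / Z) := by
      intro y
      obtain ⟨h0, h1⟩ := inner_sphereParam b w y
      rw [neg_mul_hamiltonian β J h (by omega) hσ, ← hb0, ← hb1, h0, h1]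
    simp_rw [hF]
    rw [lintegral_const_mul' _ _ ENNReal.ofReal_ne_top]
    have hH : ∫⁻ y, f (zeroExtend (k + 2) (√((k + 2 : ℕ) : ℝ) • sphereParam b w y))
          ∂(Measure.pi fun _ : Fin k => gaussianReal 0 1)
        = ∫⁻ g, f (finiteTransport h (k + 2) (diskPoint w) g) ∂standardGaussian := by
      -- Writing `|y|` as the norm of `perpPart b y` makes the integrand a function of that vector
      -- alone, so its law can be replaced.
      simp only [sphereParam, ← norm_perpPart b]
      rw [lintegral_perpPart hb0 hb1 (fun v => f (zeroExtend (k + 2) (√((k + 2 : ℕ) : ℝ) •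
        ((japaneseBracket w)⁻¹ • (planePart b w + ‖v‖⁻¹ • v))))) (by fun_prop)]
      exact lintegral_congr fun g => by rw [zeroExtend_sphereParam hb0 hb1]
    rw [hH, ← mul_assoc, ← mul_assoc, ← ENNReal.ofReal_mul
      (by have := japaneseBracket_pos w; positivity), ← ENNReal.ofReal_mul (by positivity),
      exp_mul_planeTilting]
    congr 2
    rw [← hZ']
    simp only [sampleMoments]
    field_simp
  -- Both sides are probability measures, so the constant 1 as test function forces the
  -- proportionality factor to be 1.
  have h1 := key 1 measurable_one
  have hpr : IsProbabilityMeasure (((planeMeasure β J h (k + 2)).prod standardGaussian).map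
      fun p => finiteTransport h (k + 2) (diskPoint p.1) p.2) :=
    Measure.isProbabilityMeasure_map hTm.aemeasurable
  simp only [Pi.one_apply, lintegral_one, measure_univ, mul_one] at h1
  refine Measure.ext_of_lintegral _ fun f hf => ?_
  rw [key f hf, ← h1, one_mul]

/-- The expectation of `f` under the Gaussian image with parameter `z` in volume `n`. -/
def finiteExpectation (h : ℕ → ℝ) (f : BoundedContinuousFunction (ℕ → ℝ) ℝ) (n : ℕ)
    (z : ℝ × ℝ) : ℝ :=
  ∫ g, f (finiteTransport h n z g) ∂standardGaussian

lemma abs_finiteExpectation_le (h : ℕ → ℝ) (f : BoundedContinuousFunction (ℕ → ℝ) ℝ) (n : ℕ)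
    (z : ℝ × ℝ) : |finiteExpectation h f n z| ≤ ‖f‖ := by
  have := norm_integral_le_of_norm_le_const (μ := standardGaussian)
    (f := fun g => f (finiteTransport h n z g)) (C := ‖f‖)
    (Eventually.of_forall fun g => f.norm_coe_le_norm _)
  simpa [finiteExpectation] using this

lemma measurable_finiteExpectation (h : ℕ → ℝ) (f : BoundedContinuousFunction (ℕ → ℝ) ℝ) (n : ℕ) :
    Measurable (finiteExpectation h f n) := by
  have : StronglyMeasurable fun p : (ℝ × ℝ) × (ℕ → ℝ) => f (finiteTransport h n p.1 p.2) :=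
    (f.continuous.measurable.comp (measurable_finiteTransport h n)).stronglyMeasurable
  exact this.integral_prod_right.measurable

lemma integral_gibbsMeasure (β J : ℝ) (h : ℕ → ℝ) {n : ℕ} (hn : 3 ≤ n) (hσ : 0 < sampleStd h n)
    (f : BoundedContinuousFunction (ℕ → ℝ) ℝ) :
    ∫ φ, f φ ∂(gibbsMeasure β J h n)
      = ∫ w, finiteExpectation h f n (diskPoint w) ∂(planeMeasure β J h n) := by
  have hP := isProbabilityMeasure_planeMeasure β J h hn
  have hTm : Measurable fun p : (ℝ × ℝ) × (ℕ → ℝ) =>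
      finiteTransport h n (diskPoint p.1) p.2 :=
    (measurable_finiteTransport h n).comp
      (f := fun p : (ℝ × ℝ) × (ℕ → ℝ) => (diskPoint p.1, p.2)) (by fun_prop)
  rw [gibbsMeasure_eq_map β J h hn hσ, integral_map hTm.aemeasurable
    f.continuous.measurable.aestronglyMeasurable, integral_prod]
  · rfl
  · exact Integrable.of_bound (f.continuous.measurable.comp hTm).aestronglyMeasurable ‖f‖
      (Eventually.of_forall fun _ => f.norm_coe_le_norm _)

end MeanFieldSpherical

end

/-! ### Laws of large numbers and convergence of the affine maps. -/

noncomputable section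

namespace MeanFieldSpherical

open scoped ENNReal

lemma measurePreserving_eval_standardGaussian (i : ℕ) :
    MeasurePreserving (fun g : ℕ → ℝ => g i) standardGaussian (gaussianReal 0 1) :=
  measurePreserving_eval_infinitePi (fun _ : ℕ => gaussianReal 0 1) i

lemma iIndepFun_eval_standardGaussian :
    iIndepFun (fun (i : ℕ) (g : ℕ → ℝ) => g i) standardGaussian :=
  iIndepFun_infinitePi (P := fun _ : ℕ => gaussianReal 0 1) (X := fun _ x => x)
    fun _ => measurable_id

lemma memLp_eval_standardGaussian (i : ℕ) :
    MemLp (fun g : ℕ → ℝ => g i) 2 standardGaussian :=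
  (memLp_id_gaussianReal (μ := 0) (v := 1) 2).comp_measurePreserving
    (measurePreserving_eval_standardGaussian i)

lemma integral_eval_standardGaussian (i : ℕ) : ∫ g : ℕ → ℝ, g i ∂standardGaussian = 0 := by
  rw [← integral_id_gaussianReal (μ := 0) (v := 1),
    ← (measurePreserving_eval_standardGaussian i).map_eq, integral_map (measurable_pi_apply i).aemeasurable
      (by fun_prop)]

lemma variance_eval_standardGaussian (i : ℕ) :
    Var[fun g : ℕ → ℝ => g i; standardGaussian] = 1 := by
  have h := variance_id_gaussianReal (μ := 0) (v := 1)
  have hm : AEMeasurable (fun g : ℕ → ℝ => g i) standardGaussian :=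
    (measurable_pi_apply i).aemeasurable
  rw [← (measurePreserving_eval_standardGaussian i).map_eq,
    variance_map (by fun_prop) hm] at h
  simpa [Function.comp_def] using h

lemma integral_eval_sq_standardGaussian (i : ℕ) :
    ∫ g : ℕ → ℝ, g i ^ 2 ∂standardGaussian = 1 := by
  have h := variance_eval_standardGaussian i
  rw [variance_eq_integral (measurable_pi_apply i).aemeasurable,
    integral_eval_standardGaussian] at h
  simpa using h

lemma strongLaw_standardGaussian (u : ℝ → ℝ) (hu : Measurable u)
    (hi : Integrable (fun g : ℕ → ℝ => u (g 0)) standardGaussian) :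
    ∀ᵐ g ∂standardGaussian, Tendsto (fun n : ℕ => (∑ i ∈ Finset.range n, u (g i)) / n) atTop
      (𝓝 (∫ g : ℕ → ℝ, u (g 0) ∂standardGaussian)) := by
  refine strong_law_ae_real (fun i (g : ℕ → ℝ) => u (g i)) hi (fun i j hij => ?_) fun i => ?_
  · exact (iIndepFun_eval_standardGaussian.indepFun hij).comp hu hu
  · refine IdentDistrib.comp (f := fun g : ℕ → ℝ => g i) (g := fun g : ℕ → ℝ => g 0)
      ⟨(measurable_pi_apply i).aemeasurable, (measurable_pi_apply 0).aemeasurable, ?_⟩ hu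
    rw [(measurePreserving_eval_standardGaussian i).map_eq,
      (measurePreserving_eval_standardGaussian 0).map_eq]

/-- Chebyshev's inequality; by independence the variance is the sum of the squared coefficients. -/
lemma measure_abs_sum_ge_le (c : ℕ → ℝ) (n : ℕ) {ε : ℝ} (hε : 0 < ε) :
    standardGaussian {g | ε ≤ |∑ j ∈ Finset.range n, c j * g j|}
      ≤ ENNReal.ofReal ((∑ j ∈ Finset.range n, c j ^ 2) / ε ^ 2) := by
  have hL : ∀ j ∈ Finset.range n, MemLp (fun g : ℕ → ℝ => c j * g j) 2 standardGaussian :=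
    fun j _ => (memLp_eval_standardGaussian j).const_mul (c j)
  have hv := IndepFun.variance_sum (μ := standardGaussian) hL fun i _ j _ hij =>
    (iIndepFun_eval_standardGaussian.indepFun hij).comp (φ := fun x => c i * x)
      (ψ := fun x => c j * x) (by fun_prop) (by fun_prop)
  simp only [variance_const_mul, variance_eval_standardGaussian, mul_one] at hv
  have hm : ∫ g, (∑ j ∈ Finset.range n, fun g : ℕ → ℝ => c j * g j) g ∂standardGaussian = 0 := by
    simp only [Finset.sum_apply]
    rw [integral_finsetSum _ fun j hj => (hL j hj).integrable one_le_two]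
    simp [integral_const_mul, integral_eval_standardGaussian]
  have h := meas_ge_le_variance_div_sq (μ := standardGaussian) (memLp_finsetSum' _ hL) hε
  rw [hm, hv] at h
  simpa using h

lemma sum_stdField (h : ℕ → ℝ) {n : ℕ} (hn : n ≠ 0) :
    ∑ j ∈ Finset.range n, stdField h n j = 0 := by
  simp only [stdField]
  rw [← Finset.sum_div, Finset.sum_range fun j => h j - sampleMean h n, sum_sub_sampleMean h hn,
    zero_div]

lemma sum_stdField_sq (h : ℕ → ℝ) {n : ℕ} (hn : n ≠ 0) (hσ : 0 < sampleStd h n) :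
    ∑ j ∈ Finset.range n, stdField h n j ^ 2 = n := by
  simp only [stdField, div_pow]
  rw [← Finset.sum_div, Finset.sum_range fun j => (h j - sampleMean h n) ^ 2,
    sum_sub_sampleMean_sq h hn hσ]
  have := hσ.ne'
  field_simp

/-- Pythagoras: the constants and `stdField` are orthogonal, each with squared length `n`. -/
lemma sum_perpField_sq (h : ℕ → ℝ) {n : ℕ} (hn : n ≠ 0) (hσ : 0 < sampleStd h n) (g : ℕ → ℝ) :
    (∑ j ∈ Finset.range n, perpField h n g j ^ 2) / n = (∑ j ∈ Finset.range n, g j ^ 2) / n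
      - ((∑ j ∈ Finset.range n, g j) / n) ^ 2
      - ((∑ j ∈ Finset.range n, g j * stdField h n j) / n) ^ 2 := by
  have hn' : (n : ℝ) ≠ 0 := Nat.cast_ne_zero.2 hn
  have h1 := sum_stdField h hn
  have h2 := sum_stdField_sq h hn hσ
  simp only [perpField]
  set A := (∑ j ∈ Finset.range n, g j) / n with hA
  set B := (∑ j ∈ Finset.range n, g j * stdField h n j) / n with hB
  have hA' : ∑ j ∈ Finset.range n, g j = n * A := by rw [hA]; field_simp
  have hB' : ∑ j ∈ Finset.range n, g j * stdField h n j = n * B := by rw [hB]; field_simp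
  have : ∀ j, (g j - A - B * stdField h n j) ^ 2 = g j ^ 2 + A ^ 2 + B ^ 2 * stdField h n j ^ 2
      - 2 * A * g j - 2 * B * (g j * stdField h n j) + 2 * A * B * stdField h n j :=
    fun j => by ring
  simp only [this, Finset.sum_add_distrib, Finset.sum_sub_distrib, ← Finset.mul_sum, h1, h2, hA',
    hB', Finset.sum_const, Finset.card_range, nsmul_eq_mul]
  field_simp
  ring

section Limit

variable {h : ℕ → ℝ} {m : ℝ × ℝ}

lemma IsStronglyVarying.tendsto_mean (hh : IsStronglyVarying h m) :
    Tendsto (sampleMean h) atTop (𝓝 m.1) := hh.1.fst_nhds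

lemma IsStronglyVarying.tendsto_std (hh : IsStronglyVarying h m) :
    Tendsto (sampleStd h) atTop (𝓝 m.2) := hh.1.snd_nhds

lemma IsStronglyVarying.eventually_pos (hh : IsStronglyVarying h m) :
    ∀ᶠ n in atTop, 0 < sampleStd h n := hh.tendsto_std.eventually (lt_mem_nhds hh.2)

lemma IsStronglyVarying.tendsto_stdField (hh : IsStronglyVarying h m) (i : ℕ) :
    Tendsto (fun n => stdField h n i) atTop (𝓝 ((h i - m.1) / m.2)) :=
  (tendsto_const_nhds.sub hh.tendsto_mean).div hh.tendsto_std hh.2.ne'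

/-- The coefficients change with `n`, so the strong law used for the other averages does not apply
directly. The variance is `1/n`, which gives convergence in probability. -/
lemma IsStronglyVarying.tendstoInMeasure (hh : IsStronglyVarying h m) :
    TendstoInMeasure standardGaussian
      (fun n g => (∑ j ∈ Finset.range n, g j * stdField h n j) / n) atTop fun _ => 0 := by
  rw [tendstoInMeasure_iff_norm]
  intro ε hε
  have hlim : Tendsto (fun n : ℕ => ENNReal.ofReal (1 / (n : ℝ) / ε ^ 2)) atTop (𝓝 0) := by
    have := (tendsto_one_div_atTop_nhds_zero_nat (𝕜 := ℝ)).div_const (ε ^ 2)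
    rw [zero_div] at this
    simpa using ENNReal.tendsto_ofReal this
  refine tendsto_of_tendsto_of_tendsto_of_le_of_le' tendsto_const_nhds hlim
    (Eventually.of_forall fun _ => zero_le) ?_
  filter_upwards [hh.eventually_pos, eventually_gt_atTop 0] with n hσ hn
  have hn' : (n : ℝ) ≠ 0 := Nat.cast_ne_zero.2 hn.ne'
  have := measure_abs_sum_ge_le (fun j => stdField h n j / n) n hε
  simp only [div_pow, ← Finset.sum_div, sum_stdField_sq h hn.ne' hσ] at this
  have he : ∀ g : ℕ → ℝ, ∑ j ∈ Finset.range n, stdField h n j / n * g j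
      = (∑ j ∈ Finset.range n, g j * stdField h n j) / n := fun g => by
    rw [Finset.sum_div]
    exact Finset.sum_congr rfl fun j _ => by ring
  have hc : (n : ℝ) / (n : ℝ) ^ 2 = 1 / n := by field_simp
  simp only [he, hc] at this
  simpa only [sub_zero, Real.norm_eq_abs] using this

/-- Pointwise convergence of the finite-volume affine maps. -/
lemma IsStronglyVarying.tendsto_finiteTransport (hh : IsStronglyVarying h m) {g : ℕ → ℝ}
    {z : ℝ × ℝ} {N : ℕ → ℕ} {Z : ℕ → ℝ × ℝ} (hN : Tendsto N atTop atTop)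
    (hZ : Tendsto Z atTop (𝓝 z))
    (hA : Tendsto (fun n : ℕ => (∑ i ∈ Finset.range n, g i) / n) atTop (𝓝 0))
    (hQ : Tendsto (fun n : ℕ => (∑ i ∈ Finset.range n, g i ^ 2) / n) atTop (𝓝 1))
    (hB : Tendsto (fun j => (∑ i ∈ Finset.range (N j), g i * stdField h (N j) i) / (N j : ℝ))
      atTop (𝓝 0)) :
    Tendsto (fun j => finiteTransport h (N j) (Z j) g) atTop (𝓝 (transport h m z g)) := by
  rw [tendsto_pi_nhds]
  intro i
  have hs := (hh.tendsto_stdField i).comp hN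
  have hY : Tendsto (fun j => perpField h (N j) g i) atTop (𝓝 (g i)) := by
    have := ((tendsto_const_nhds (x := g i)).sub (hA.comp hN)).sub (hB.mul hs)
    simpa [perpField] using this
  have hS : Tendsto (fun j => (∑ l ∈ Finset.range (N j), perpField h (N j) g l ^ 2) / (N j : ℝ))
      atTop (𝓝 1) := by
    have := ((hQ.comp hN).sub ((hA.comp hN).pow 2)).sub (hB.pow 2)
    norm_num at this
    refine this.congr' ?_
    filter_upwards [hN.eventually hh.eventually_pos, hN.eventually (eventually_gt_atTop 0)]
      with j hσ hn
    exact (sum_perpField_sq h hn.ne' hσ g).symm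
  have hR := hY.div hS.sqrt (by norm_num)
  have hZ1 := hZ.fst_nhds
  have hZ2 := hZ.snd_nhds
  have hr : Tendsto (fun j => √(1 - ((Z j).1 ^ 2 + (Z j).2 ^ 2))) atTop
      (𝓝 (√(1 - (z.1 ^ 2 + z.2 ^ 2)))) :=
    (tendsto_const_nhds.sub ((hZ1.pow 2).add (hZ2.pow 2))).sqrt
  have := (hZ1.add (hZ2.mul hs)).add (hr.mul hR)
  have hlim : transport h m z g i = z.1 + z.2 * ((h i - m.1) / m.2)
      + √(1 - (z.1 ^ 2 + z.2 ^ 2)) * (g i / √1) := by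
    rw [transport, Real.sqrt_one, div_one]
    ring
  rw [hlim]
  refine this.congr' ?_
  filter_upwards [hN.eventually (eventually_gt_atTop i)] with j hj
  simp only [finiteTransport, if_pos hj, Function.comp_apply, Pi.div_apply]
  rw [Real.sqrt_div (Finset.sum_nonneg fun _ _ => sq_nonneg _), div_div_eq_mul_div]
  ring

/-- The finite-volume expectations converge, jointly in the volume and in the parameter. -/
theorem IsStronglyVarying.tendsto_finiteExpectation (hh : IsStronglyVarying h m)
    (f : BoundedContinuousFunction (ℕ → ℝ) ℝ) (z : ℝ × ℝ) :
    Tendsto (fun p : ℕ × (ℝ × ℝ) => finiteExpectation h f p.1 p.2) (atTop ×ˢ 𝓝 z)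
      (𝓝 (∫ φ, f φ ∂(pureState h m z : Measure (ℕ → ℝ)))) := by
  -- Passing to subsequences upgrades convergence in probability to almost sure convergence, as
  -- dominated convergence is applied pointwise.
  refine tendsto_of_subseq_tendsto fun u hu => ?_
  have hu1 : Tendsto (fun j => (u j).1) atTop atTop := tendsto_fst.comp hu
  have hu2 : Tendsto (fun j => (u j).2) atTop (𝓝 z) := tendsto_snd.comp hu
  obtain ⟨ms, hms, hae⟩ := (hh.tendstoInMeasure.comp hu1).exists_seq_tendsto_ae
  refine ⟨ms, ?_⟩
  have hms' := hms.tendsto_atTop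
  have hlim : ∫ φ, f φ ∂(pureState h m z : Measure (ℕ → ℝ))
      = ∫ g, f (transport h m z g) ∂standardGaussian :=
    integral_map (measurable_transport h m z).aemeasurable
      f.continuous.measurable.aestronglyMeasurable
  rw [hlim]
  have hA := strongLaw_standardGaussian (fun x => x) measurable_id
    ((memLp_eval_standardGaussian 0).integrable one_le_two)
  have hQ := strongLaw_standardGaussian (fun x => x ^ 2) (by fun_prop)
    (memLp_eval_standardGaussian 0).integrable_sq
  rw [integral_eval_standardGaussian] at hA
  rw [integral_eval_sq_standardGaussian] at hQ
  refine tendsto_integral_filter_of_dominated_convergence (fun _ => ‖f‖)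
    (Eventually.of_forall fun j => ?_) (Eventually.of_forall fun j => ?_) (integrable_const _) ?_
  · have : Measurable fun g => finiteTransport h (u (ms j)).1 (u (ms j)).2 g :=
      (measurable_finiteTransport h (u (ms j)).1).comp measurable_prodMk_left
    exact (f.continuous.measurable.comp this).aestronglyMeasurable
  · exact Eventually.of_forall fun g => f.norm_coe_le_norm _
  · filter_upwards [hA, hQ, hae] with g hgA hgQ hgB
    exact (f.continuous.tendsto _).comp (hh.tendsto_finiteTransport (hu1.comp hms')
      (hu2.comp hms') hgA hgQ hgB)

end Limit

end MeanFieldSpherical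

end

/-! ### Laplace's method for the law of the plane coordinates. -/

noncomputable section

namespace MeanFieldSpherical

open scoped ENNReal

/-- The moments enter linearly, paired with a point of the bounded disk. The bound is uniform in
`w`, which allows the sample moments to be replaced by their limits. -/
lemma abs_planeTilting_sub_le (β J : ℝ) (m m' w : ℝ × ℝ) :
    |planeTilting β J m' w - planeTilting β J m w|
      ≤ |β| * (|m'.1 - m.1| + |m'.2 - m.2|) := by
  obtain ⟨h1, h2⟩ := abs_diskPoint_le w
  have : planeTilting β J m' w - planeTilting β J m w
      = β * ((m'.1 - m.1) * (diskPoint w).1 + (m'.2 - m.2) * (diskPoint w).2) := by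
    simp only [planeTilting, tilting]
    ring
  rw [this, abs_mul]
  refine mul_le_mul_of_nonneg_left ((abs_add_le _ _).trans ?_) (abs_nonneg _)
  rw [abs_mul, abs_mul]
  exact add_le_add (mul_le_of_le_one_right (abs_nonneg _) h1)
    (mul_le_of_le_one_right (abs_nonneg _) h2)

/-- The energy is bounded on the disk while minus the logarithm of the bracket diverges. This
supplies the compactness needed on the unbounded plane. -/
lemma tendsto_planeTilting_cocompact (β J : ℝ) (m : ℝ × ℝ) :
    Tendsto (planeTilting β J m) (cocompact (ℝ × ℝ)) atBot := by
  have hJ : Tendsto japaneseBracket (cocompact (ℝ × ℝ)) atTop := by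
    refine tendsto_atTop_mono (fun w => ?_) (tendsto_norm_cocompact_atTop (E := ℝ × ℝ))
    apply Real.le_sqrt_of_sq_le
    rcases max_choice ‖w.1‖ ‖w.2‖ with h | h <;> rw [Prod.norm_def, h, Real.norm_eq_abs, sq_abs] <;>
      nlinarith [sq_nonneg w.1, sq_nonneg w.2]
  have hlog := tendsto_neg_atTop_atBot.comp (Real.tendsto_log_atTop.comp hJ)
  refine tendsto_atBot_mono (fun w => ?_)
    (tendsto_atBot_add_const_left _ (|β * J / 2| + |β| * (|m.1| + |m.2|)) hlog)
  obtain ⟨h1, h2⟩ := abs_diskPoint_le w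
  have hq := exponent_le β J m w
  rw [planeTilting_eq]
  simp only [Function.comp_apply]
  linarith

/-- Away from the maximisers the tilting function stays below its maximum. -/
lemma exists_lt_of_isClosed {β J : ℝ} {m : ℝ × ℝ} {A : Set (ℝ × ℝ)} (hA : IsClosed A)
    {w₀ : ℝ × ℝ} (hlt : ∀ w ∈ A, planeTilting β J m w < planeTilting β J m w₀) :
    ∃ a < planeTilting β J m w₀, ∀ w ∈ A, planeTilting β J m w ≤ a := by
  set Ψ := planeTilting β J m
  have hc : Continuous Ψ := continuous_planeTilting β J m
  obtain ⟨K, hK, hKs⟩ := mem_cocompact.1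
    ((tendsto_planeTilting_cocompact β J m).eventually (eventually_lt_atBot (Ψ w₀ - 1)))
  rcases (A ∩ K).eq_empty_or_nonempty with h | h
  · refine ⟨Ψ w₀ - 1, by linarith, fun w hw => ?_⟩
    have : w ∉ K := fun hwK => (Set.eq_empty_iff_forall_notMem.1 h) w ⟨hw, hwK⟩
    exact (hKs this : Ψ w < Ψ w₀ - 1).le
  · obtain ⟨v, hv, hmax⟩ := (hK.inter_left hA).exists_isMaxOn h hc.continuousOn
    refine ⟨max (Ψ v) (Ψ w₀ - 1), max_lt (hlt v hv.1) (by linarith), fun w hw => ?_⟩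
    by_cases hwK : w ∈ K
    · exact (hmax ⟨hw, hwK⟩).trans (le_max_left _ _)
    · exact (hKs hwK : Ψ w < Ψ w₀ - 1).le.trans (le_max_right _ _)

/-- The law of the plane coordinates is exponentially small where the tilting function stays
below its maximum. -/
lemma tendsto_planeMeasure_of_le {β J : ℝ} {h : ℕ → ℝ} {m : ℝ × ℝ} (hh : IsStronglyVarying h m)
    {A : Set (ℝ × ℝ)} (hA : MeasurableSet A) {a : ℝ} {w₀ : ℝ × ℝ}
    (ha : a < planeTilting β J m w₀) (hle : ∀ w ∈ A, planeTilting β J m w ≤ a) :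
    Tendsto (fun n => (planeMeasure β J h n).real A) atTop (𝓝 0) := by
  set Ψ := planeTilting β J m with hΨ
  have hc : Continuous Ψ := continuous_planeTilting β J m
  obtain ⟨b, hab, hb⟩ := exists_between ha
  -- `V` bounds the normalising integral from below; the ball keeps its volume finite.
  set V := {w | b < Ψ w} ∩ Metric.ball w₀ 1 with hV
  have hVo : IsOpen V := (isOpen_lt continuous_const hc).inter Metric.isOpen_ball
  have hV0 : 0 < volume.real V := by
    refine ENNReal.toReal_pos (hVo.measure_pos _ ⟨w₀, hb, Metric.mem_ball_self one_pos⟩).ne' ?_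
    exact ((measure_mono Set.inter_subset_right).trans_lt measure_ball_lt_top).ne
  -- Three of the `n` powers are kept for integrability over a possibly unbounded `A`; the other `n
  -- - 3` are bounded using `a`.
  set I := ∫ w, Real.exp ((3 : ℕ) * Ψ w) with hI
  have hI0 : 0 ≤ I := integral_nonneg fun _ => (Real.exp_pos _).le
  have hI3 := integrable_exp_planeTilting β J m le_rfl
  set ε : ℕ → ℝ := fun n => |β| * (|sampleMean h n - m.1| + |sampleStd h n - m.2|) with hε
  have hεlim : Tendsto ε atTop (𝓝 0) := by
    have h1 := (hh.tendsto_mean.sub_const m.1).abs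
    have h2 := (hh.tendsto_std.sub_const m.2).abs
    simpa using (h1.add h2).const_mul |β|
  -- Numerator and denominator each lose at most `n ε n < n δ`, so of the gap `4 δ n` at least `2 δ
  -- n` remains.
  set δ := (b - a) / 4 with hδ
  have hδ0 : 0 < δ := by rw [hδ]; linarith
  have hlim : Tendsto (fun n : ℕ => I * Real.exp (-3 * a) / volume.real V
      * Real.exp (-(2 * δ) * n)) atTop (𝓝 0) := by
    have h1 : Tendsto (fun n : ℕ => -(2 * δ) * (n : ℝ)) atTop atBot :=
      tendsto_natCast_atTop_atTop.const_mul_atTop_of_neg (by linarith)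
    simpa using (Real.tendsto_exp_atBot.comp h1).const_mul (I * Real.exp (-3 * a) / volume.real V)
  refine tendsto_of_tendsto_of_tendsto_of_le_of_le' tendsto_const_nhds hlim
    (Eventually.of_forall fun _ => measureReal_nonneg) ?_
  filter_upwards [hεlim.eventually (gt_mem_nhds hδ0), eventually_ge_atTop 3] with n hn hn3
  have hn0 : (0 : ℝ) ≤ n := Nat.cast_nonneg n
  have hn3' : (3 : ℝ) ≤ n := by exact_mod_cast hn3
  set Ψn := planeTilting β J (sampleMoments h n) with hΨn
  have hdiff : ∀ w, |Ψn w - Ψ w| ≤ ε n := fun w =>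
    abs_planeTilting_sub_le β J m (sampleMoments h n) w
  have hIn := integrable_exp_planeTilting β J (sampleMoments h n) hn3
  have hnum : ∫ w in A, Real.exp (n * Ψn w) ≤ Real.exp (n * ε n + (n - 3) * a) * I := by
    calc ∫ w in A, Real.exp (n * Ψn w)
        ≤ ∫ w in A, Real.exp (n * ε n + (n - 3) * a) * Real.exp ((3 : ℕ) * Ψ w) := by
          refine setIntegral_mono_on hIn.integrableOn (hI3.const_mul _).integrableOn hA
            fun w hw => ?_
          rw [← Real.exp_add, Real.exp_le_exp]
          have h1 := (abs_le.1 (hdiff w)).2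
          have h2 := mul_le_mul_of_nonneg_left h1 hn0
          have h3 := mul_le_mul_of_nonneg_left (hle w hw) (sub_nonneg.2 hn3')
          push_cast
          linarith
      _ ≤ ∫ w, Real.exp (n * ε n + (n - 3) * a) * Real.exp ((3 : ℕ) * Ψ w) :=
          setIntegral_le_integral (hI3.const_mul _)
            (Eventually.of_forall fun _ => by positivity)
      _ = Real.exp (n * ε n + (n - 3) * a) * I := integral_const_mul _ _
  have hden : Real.exp (n * (b - ε n)) * volume.real V ≤ ∫ w, Real.exp (n * Ψn w) := by
    calc Real.exp (n * (b - ε n)) * volume.real V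
        = ∫ _ in V, Real.exp (n * (b - ε n)) := by
          rw [setIntegral_const, smul_eq_mul, mul_comm]
      _ ≤ ∫ w in V, Real.exp (n * Ψn w) := by
          refine setIntegral_mono_on ?_ hIn.integrableOn hVo.measurableSet fun w hw => ?_
          · exact integrableOn_const
              (((measure_mono Set.inter_subset_right).trans_lt measure_ball_lt_top).ne)
          · have h1 := (abs_le.1 (hdiff w)).1
            have h2 : b < Ψ w := hw.1
            exact Real.exp_le_exp.2 (mul_le_mul_of_nonneg_left (by linarith) hn0)
      _ ≤ ∫ w, Real.exp (n * Ψn w) :=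
          setIntegral_le_integral hIn (Eventually.of_forall fun _ => (Real.exp_pos _).le)
  have hP : (planeMeasure β J h n).real A
      = (∫ w in A, Real.exp (n * Ψn w)) / ∫ w, Real.exp (n * Ψn w) := by
    rw [measureReal_def, planeMeasure, tilted_apply_eq_ofReal_integral _ A, integral_div,
      ENNReal.toReal_ofReal]
    exact div_nonneg (integral_nonneg fun _ => (Real.exp_pos _).le)
      (integral_nonneg fun _ => (Real.exp_pos _).le)
  rw [hP]
  calc (∫ w in A, Real.exp (n * Ψn w)) / ∫ w, Real.exp (n * Ψn w)
      ≤ (Real.exp (n * ε n + (n - 3) * a) * I) / (Real.exp (n * (b - ε n)) * volume.real V) :=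
        div_le_div₀ (by positivity) hnum (by positivity) hden
    _ = I / volume.real V * Real.exp (n * ε n + (n - 3) * a - n * (b - ε n)) := by
        rw [Real.exp_sub]
        field_simp
    _ ≤ I / volume.real V * Real.exp (-3 * a + -(2 * δ) * n) := by
        refine mul_le_mul_of_nonneg_left (Real.exp_le_exp.2 ?_) (by positivity)
        have h1 := mul_le_mul_of_nonneg_left hn.le hn0
        have h2 : n * b = n * (a + 4 * δ) := by rw [hδ]; ring
        nlinarith
    _ = I * Real.exp (-3 * a) / volume.real V * Real.exp (-(2 * δ) * n) := by
        rw [Real.exp_add]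
        ring

/-- The inverse is `z ↦ z / √(1 - |z|²)`, which also provides the preimage in `exists_diskPoint_eq`.
-/
lemma diskPoint_injective : Function.Injective diskPoint := by
  have key : ∀ w, w = ((diskPoint w).1 / √(1 - ((diskPoint w).1 ^ 2 + (diskPoint w).2 ^ 2)),
      (diskPoint w).2 / √(1 - ((diskPoint w).1 ^ 2 + (diskPoint w).2 ^ 2))) := by
    intro w
    have hJ := japaneseBracket_pos w
    rw [one_sub_diskPoint, Real.sqrt_inv, Real.sqrt_sq hJ.le]
    ext <;> simp only [diskPoint] <;> field_simp
  intro w v hwv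
  rw [key w, key v, hwv]

lemma diskPoint_mem_disk (w : ℝ × ℝ) : diskPoint w ∈ disk := by
  have h1 := one_sub_diskPoint w
  have h2 : 0 < (japaneseBracket w ^ 2)⁻¹ := by have := japaneseBracket_pos w; positivity
  change (diskPoint w).1 ^ 2 + (diskPoint w).2 ^ 2 < 1
  linarith

lemma exists_diskPoint_eq {z : ℝ × ℝ} (hz : z ∈ disk) : ∃ w, diskPoint w = z := by
  have hz' : 0 < 1 - (z.1 ^ 2 + z.2 ^ 2) := sub_pos.2 hz
  set r := √(1 - (z.1 ^ 2 + z.2 ^ 2)) with hr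
  have hr0 : 0 < r := Real.sqrt_pos.2 hz'
  have hr2 : r ^ 2 = 1 - (z.1 ^ 2 + z.2 ^ 2) := Real.sq_sqrt hz'.le
  have hJ : japaneseBracket (z.1 / r, z.2 / r) = r⁻¹ := by
    rw [japaneseBracket, Real.sqrt_eq_iff_mul_self_eq (by positivity) (by positivity)]
    field_simp
    linarith
  refine ⟨(z.1 / r, z.2 / r), ?_⟩
  simp only [diskPoint, hJ]
  ext <;> simp only <;> field_simp

/-- Laplace's principle: integrals against the law of the plane coordinates only depend on the
integrand near the maximisers. -/
theorem tendsto_integral_planeMeasure {β J : ℝ} {h : ℕ → ℝ} {m : ℝ × ℝ}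
    (hh : IsStronglyVarying h m) (hfin : (maximizers β J m).Finite)
    (hne : (maximizers β J m).Nonempty) (G : ℕ → ℝ × ℝ → ℝ)
    {C : ℝ} (hC : ∀ n w, |G n w| ≤ C)
    (hG : ∀ w, diskPoint w ∈ maximizers β J m →
      Tendsto (fun p : ℕ × (ℝ × ℝ) => G p.1 p.2) (atTop ×ˢ 𝓝 w) (𝓝 0)) :
    Tendsto (fun n => ∫ w, G n w ∂(planeMeasure β J h n)) atTop (𝓝 0) := by
  set M := diskPoint ⁻¹' maximizers β J m with hM
  have hMfin : M.Finite := hfin.preimage diskPoint_injective.injOn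
  rw [Metric.tendsto_nhds]
  intro ε hε
  -- Joint convergence in volume and point gives one neighbourhood that works for all large `n`.
  have hloc : ∀ w ∈ M, ∃ U : Set (ℝ × ℝ), IsOpen U ∧ w ∈ U ∧
      ∀ᶠ n in atTop, ∀ x ∈ U, |G n x| < ε / 2 := by
    intro w hw
    have := (hG w hw).eventually (Metric.ball_mem_nhds 0 (half_pos hε))
    obtain ⟨p, hp, q, hq, hpq⟩ := eventually_prod_iff.1 this
    obtain ⟨U, hUq, hUo, hwU⟩ := mem_nhds_iff.1 hq
    refine ⟨U, hUo, hwU, hp.mono fun n hn x hx => ?_⟩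
    have := hpq hn (hUq hx)
    simpa using this
  choose! U hUo hwU hU using hloc
  -- The integral is bounded by `ε / 2` off `A` and by `C` times the vanishing mass of `A`.
  set A := (⋃ w ∈ M, U w)ᶜ with hA
  have hAc : IsClosed A := (isOpen_biUnion fun w hw => hUo w hw).isClosed_compl
  obtain ⟨z, hz⟩ := hne
  obtain ⟨w₀, rfl⟩ := exists_diskPoint_eq hz.1
  have hAlt : ∀ w ∈ A, planeTilting β J m w < planeTilting β J m w₀ := by
    intro w hw
    refine lt_of_le_of_ne (hz.2 _ (diskPoint_mem_disk w)) fun heq => hw ?_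
    have hwM : w ∈ M := ⟨diskPoint_mem_disk w, fun v hv => (hz.2 v hv).trans heq.ge⟩
    exact Set.mem_biUnion hwM (hwU w hwM)
  obtain ⟨a, ha, hle⟩ := exists_lt_of_isClosed hAc hAlt
  have hP := tendsto_planeMeasure_of_le (h := h) hh hAc.measurableSet ha hle
  have hCP := (hP.const_mul C).eventually (gt_mem_nhds (show C * 0 < ε / 2 by
    rw [mul_zero]; exact half_pos hε))
  filter_upwards [hCP, (hMfin.eventually_all).2 hU, eventually_ge_atTop 3] with n h1 h2 h3
  have hpr := isProbabilityMeasure_planeMeasure β J h h3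
  rw [dist_zero_right]
  have hint : Integrable (fun w => ε / 2 + A.indicator (fun _ => C) w) (planeMeasure β J h n) :=
    (integrable_const _).add ((integrable_const C).indicator hAc.measurableSet)
  refine (norm_integral_le_of_norm_le hint (Eventually.of_forall fun w => ?_)).trans_lt ?_
  · by_cases hw : w ∈ A
    · rw [Set.indicator_of_mem hw, Real.norm_eq_abs]
      linarith [hC n w]
    · rw [Set.indicator_of_notMem hw, Real.norm_eq_abs, add_zero]
      obtain ⟨v, hv, hwv⟩ := Set.mem_iUnion₂.1 (Set.notMem_compl_iff.1 hw)
      exact (h2 v hv w hwv).le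
  · rw [integral_add (integrable_const _) ((integrable_const C).indicator hAc.measurableSet),
      integral_indicator hAc.measurableSet, setIntegral_const]
    simp only [integral_const, smul_eq_mul, probReal_univ, one_mul]
    linarith [mul_comm C ((planeMeasure β J h n).real A)]

end MeanFieldSpherical

end

/-! ### Identification of the limit points. -/

noncomputable section

namespace MeanFieldSpherical

/-- Finite-volume expectations are asymptotically mixtures of expectations under pure states;
`S` selects the pure-state expectation belonging to a plane coordinate. -/
theorem tendsto_integral_gibbsMeasure_sub {β J : ℝ} {h : ℕ → ℝ} {m : ℝ × ℝ}
    (hh : IsStronglyVarying h m) (hfin : (maximizers β J m).Finite)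
    (hne : (maximizers β J m).Nonempty) (f : BoundedContinuousFunction (ℕ → ℝ) ℝ)
    (S : ℝ × ℝ → ℝ) (hSm : Measurable S) {C : ℝ} (hSC : ∀ w, |S w| ≤ C)
    (hS : ∀ w, diskPoint w ∈ maximizers β J m → Tendsto S (𝓝 w)
      (𝓝 (∫ φ, f φ ∂(pureState h m (diskPoint w) : Measure (ℕ → ℝ))))) :
    Tendsto (fun n => ∫ φ, f φ ∂(gibbsMeasure β J h n) - ∫ w, S w ∂(planeMeasure β J h n))
      atTop (𝓝 0) := by
  have key := tendsto_integral_planeMeasure hh hfin hne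
    (fun n w => finiteExpectation h f n (diskPoint w) - S w) (C := ‖f‖ + C)
    (fun n w => (abs_sub _ _).trans (add_le_add (abs_finiteExpectation_le h f n _) (hSC w)))
    fun w hw => by
      have h1 : Tendsto (fun p : ℕ × (ℝ × ℝ) => (p.1, diskPoint p.2)) (atTop ×ˢ 𝓝 w)
          (atTop ×ˢ 𝓝 (diskPoint w)) :=
        tendsto_fst.prodMk ((continuous_diskPoint.tendsto w).comp tendsto_snd)
      have h2 := ((hh.tendsto_finiteExpectation f (diskPoint w)).comp h1).sub
        ((hS w hw).comp tendsto_snd)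
      rwa [sub_self] at h2
  refine key.congr' ?_
  filter_upwards [hh.eventually_pos, eventually_ge_atTop 3] with n hσ hn
  have := isProbabilityMeasure_planeMeasure β J h hn
  rw [integral_gibbsMeasure β J h hn hσ, integral_sub]
  · exact Integrable.of_bound ((measurable_finiteExpectation h f n).comp
      continuous_diskPoint.measurable).aestronglyMeasurable ‖f‖
      (Eventually.of_forall fun w => abs_finiteExpectation_le h f n _)
  · exact Integrable.of_bound hSm.aestronglyMeasurable C (Eventually.of_forall hSC)

lemma abs_integral_le_norm (μ : ProbabilityMeasure (ℕ → ℝ))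
    (f : BoundedContinuousFunction (ℕ → ℝ) ℝ) : |∫ φ, f φ ∂(μ : Measure (ℕ → ℝ))| ≤ ‖f‖ :=
  BoundedContinuousFunction.norm_integral_le_norm (μ := (μ : Measure (ℕ → ℝ))) f

/-- With a unique maximiser the finite-volume Gibbs states converge to the pure state. -/
theorem tendsto_gibbsState_of_unique {β J : ℝ} {h : ℕ → ℝ} {m z : ℝ × ℝ}
    (hh : IsStronglyVarying h m) (hM : maximizers β J m = {z}) {k : ℕ → ℕ+} (hk : StrictMono k) :
    Tendsto (fun j => gibbsState β J h (k j)) atTop (𝓝 (pureState h m z)) := by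
  rw [ProbabilityMeasure.tendsto_iff_forall_integral_tendsto]
  intro f
  have hkt : Tendsto (fun j => (k j : ℕ)) atTop atTop :=
    StrictMono.tendsto_atTop fun _ _ hij => hk hij
  have key := tendsto_integral_gibbsMeasure_sub hh (by rw [hM]; exact Set.finite_singleton z)
    (by rw [hM]; exact Set.singleton_nonempty z) f
    (fun _ => ∫ φ, f φ ∂(pureState h m z : Measure (ℕ → ℝ))) measurable_const
    (fun _ => abs_integral_le_norm _ f) fun w hw => by
      rw [hM] at hw
      rw [Set.mem_singleton_iff.1 hw]
      exact tendsto_const_nhds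
  have key2 := (key.comp hkt).add_const (∫ φ, f φ ∂(pureState h m z : Measure (ℕ → ℝ)))
  rw [zero_add] at key2
  refine key2.congr' ?_
  filter_upwards [hkt.eventually (eventually_ge_atTop 3)] with j hj
  have := isProbabilityMeasure_planeMeasure β J h hj
  simp [gibbsState]

/-- With two maximisers on opposite sides, limits of the finite-volume Gibbs states are mixtures
of the two pure states. -/
theorem mem_convPair_of_tendsto {β J : ℝ} {h : ℕ → ℝ} {m zp zm : ℝ × ℝ}
    (hh : IsStronglyVarying h m) (hM : maximizers β J m = {zp, zm}) (hp : 0 < zp.1)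
    (hm : zm.1 < 0) {k : ℕ → ℕ+} (hk : StrictMono k) {μ : ProbabilityMeasure (ℕ → ℝ)}
    (hμ : Tendsto (fun j => gibbsState β J h (k j)) atTop (𝓝 μ)) :
    μ ∈ convPair (pureState h m zp) (pureState h m zm) := by
  -- `diskPoint` preserves the sign of the first component, so this half-plane separates the two
  -- maximisers.
  set H : Set (ℝ × ℝ) := {w | 0 < w.1} with hH
  have hHm : MeasurableSet H := measurableSet_lt measurable_const measurable_fst
  have hk' : StrictMono fun j => (k j : ℕ) := fun _ _ hij => hk hij
  -- The shift by 3 guarantees that every mixing law considered is a probability measure.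
  have hk3 : ∀ j, 3 ≤ (k (j + 3) : ℕ) := fun j =>
    (Nat.le_add_left 3 j).trans (hk'.le_apply (x := j + 3))
  have hpr := fun j => isProbabilityMeasure_planeMeasure β J h (hk3 j)
  -- The weight is a limit point of the masses of `H`; it is fixed before any test function, so one
  -- `t` serves them all.
  obtain ⟨t, ht, ms, hms, htlim⟩ := isCompact_Icc.tendsto_subseq
    (x := fun j => (planeMeasure β J h (k (j + 3))).real H) (s := Set.Icc (0 : ℝ) 1)
    fun j => ⟨measureReal_nonneg, measureReal_le_one⟩
  have hsub : Tendsto (fun j => ms j + 3) atTop atTop :=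
    (tendsto_add_atTop_nat 3).comp hms.tendsto_atTop
  have hkt : Tendsto (fun j => (k (ms j + 3) : ℕ)) atTop atTop :=
    hk'.tendsto_atTop.comp hsub
  refine ⟨t, ht, ?_⟩
  have hfin : IsFiniteMeasure (ENNReal.ofReal t • (pureState h m zp : Measure (ℕ → ℝ))
      + ENNReal.ofReal (1 - t) • (pureState h m zm : Measure (ℕ → ℝ))) := by
    have h1 := Measure.smul_finite (pureState h m zp : Measure (ℕ → ℝ))
      (ENNReal.ofReal_ne_top (r := t))
    have h2 := Measure.smul_finite (pureState h m zm : Measure (ℕ → ℝ))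
      (ENNReal.ofReal_ne_top (r := 1 - t))
    infer_instance
  refine ext_of_forall_integral_eq_of_IsFiniteMeasure fun f => ?_
  set Kp := ∫ φ, f φ ∂(pureState h m zp : Measure (ℕ → ℝ)) with hKp
  set Km := ∫ φ, f φ ∂(pureState h m zm : Measure (ℕ → ℝ)) with hKm
  have hR : ∫ φ, f φ ∂(ENNReal.ofReal t • (pureState h m zp : Measure (ℕ → ℝ))
      + ENNReal.ofReal (1 - t) • (pureState h m zm : Measure (ℕ → ℝ)))
      = t * Kp + (1 - t) * Km := by
    rw [integral_add_measure ((f.integrable _).smul_measure ENNReal.ofReal_ne_top)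
      ((f.integrable _).smul_measure ENNReal.ofReal_ne_top), integral_smul_measure,
      integral_smul_measure, ENNReal.toReal_ofReal ht.1, ENNReal.toReal_ofReal (sub_nonneg.2 ht.2),
      smul_eq_mul, smul_eq_mul]
  rw [hR]
  -- `S` is locally constant near both maximisers, and its integral is affine in the mass of `H`.
  set S : ℝ × ℝ → ℝ := fun w => H.indicator (fun _ => Kp - Km) w + Km with hS
  have hSH : ∀ w ∈ H, S w = Kp := fun w hw => by simp only [hS, Set.indicator_of_mem hw]; ring
  have hSH' : ∀ w ∉ H, S w = Km := fun w hw => by simp [hS, Set.indicator_of_notMem hw]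
  have hlim1 : Tendsto (fun j => ∫ φ, f φ ∂(gibbsMeasure β J h (k (ms j + 3)))) atTop
      (𝓝 (∫ φ, f φ ∂(μ : Measure (ℕ → ℝ)))) :=
    (ProbabilityMeasure.tendsto_iff_forall_integral_tendsto.1 hμ f).comp hsub
  have key := tendsto_integral_gibbsMeasure_sub hh (β := β) (J := J)
    (by rw [hM]; exact (Set.finite_singleton zm).insert zp)
    (by rw [hM]; exact Set.insert_nonempty _ _) f S
    ((measurable_const.indicator hHm).add measurable_const) (C := ‖f‖)
    (fun w => by
      by_cases hw : w ∈ H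
      · rw [hSH w hw]; exact abs_integral_le_norm _ f
      · rw [hSH' w hw]; exact abs_integral_le_norm _ f)
    (fun w hw => by
      have hJ := japaneseBracket_pos w
      rw [hM] at hw
      rcases hw with hw | hw
      · have h1 : 0 < w.1 := by
          rw [← hw] at hp
          exact (div_pos_iff_of_pos_right hJ).1 hp
        rw [hw, ← hKp]
        refine tendsto_const_nhds.congr' ?_
        filter_upwards [(isOpen_lt continuous_const continuous_fst).mem_nhds h1] with x hx
        exact (hSH x hx).symm
      · have hw' : diskPoint w = zm := hw
        have h1 : w.1 < 0 := by
          rw [← hw'] at hm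
          exact not_le.1 fun hc => hm.not_ge (div_nonneg hc hJ.le)
        rw [hw', ← hKm]
        refine tendsto_const_nhds.congr' ?_
        filter_upwards [(isOpen_lt continuous_fst continuous_const).mem_nhds h1] with x hx
        exact (hSH' x (not_lt.2 (le_of_lt hx))).symm)
  have hlim2 := hlim1.sub (key.comp hkt)
  rw [sub_zero] at hlim2
  refine tendsto_nhds_unique hlim2 ?_
  have hlim3 : Tendsto (fun j => (planeMeasure β J h (k (ms j + 3))).real H * (Kp - Km) + Km) atTop
      (𝓝 (t * (Kp - Km) + Km)) := (htlim.mul_const _).add_const _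
  rw [show t * Kp + (1 - t) * Km = t * (Kp - Km) + Km by ring]
  refine hlim3.congr fun j => ?_
  have := hpr (ms j)
  simp only [Function.comp_apply, sub_sub_cancel, hS]
  rw [integral_add ((integrable_const _).indicator hHm) (integrable_const _),
    integral_indicator hHm, setIntegral_const]
  simp

end MeanFieldSpherical

end

/-! ### The pure and mixed state ranges. -/

theorem mainTheorem6 (β J : ℝ) (hβ : 0 < β) (hJ : 0 < J) (h : ℕ → ℝ) (m : ℝ × ℝ)
    (hh : MeanFieldSpherical.IsStronglyVarying h m) :
    (∀ z : ℝ × ℝ, MeanFieldSpherical.maximizers β J m = {z} →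
      MeanFieldSpherical.infiniteVolumeGibbsStates β J h =
        {MeanFieldSpherical.pureState h m z}) ∧
    ((MeanFieldSpherical.maximizers β J m).encard = 2 →
      ∃ zp zm : ℝ × ℝ, 0 < zp.1 ∧ zm.1 < 0 ∧
        MeanFieldSpherical.maximizers β J m = {zp, zm} ∧
        MeanFieldSpherical.infiniteVolumeGibbsStates β J h ⊆
          MeanFieldSpherical.convPair (MeanFieldSpherical.pureState h m zp)
            (MeanFieldSpherical.pureState h m zm)) := by
  refine ⟨fun z hM => ?_, fun h2 => ?_⟩
  · ext μ
    constructor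
    · rintro ⟨k, hk, hμ⟩
      exact tendsto_nhds_unique hμ (MeanFieldSpherical.tendsto_gibbsState_of_unique hh hM hk)
    · rintro rfl
      -- The full sequence of volumes shows that the pure state is attained as a limit.
      have hk : StrictMono Nat.succPNat := Nat.succPNat_strictMono
      exact ⟨_, hk, MeanFieldSpherical.tendsto_gibbsState_of_unique hh hM hk⟩
  · obtain ⟨zp, zm, hp, hm, hM⟩ :=
      MeanFieldSpherical.exists_pair_of_encard_maximizers hβ hJ h2
    refine ⟨zp, zm, hp, hm, hM, ?_⟩
    rintro μ ⟨k, hk, hμ⟩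
    exact MeanFieldSpherical.mem_convPair_of_tendsto hh hM hp hm hk hμ
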